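/- **Conventions.** All vector lattices are real. A vector lattice $E$ is Archimedean if $0\le f$ and $nf\le g$ for all $n\in\mathbb N$ imply $f=0$. A sequence $(f_n)$ in $E$ converges relatively uniformly to $f\in E$ (written $f_n\overset{ru}{\to}f$) if there is $0<p\in E$ such that for every real $\epsilon>0$ there is $N$ with $|f_n-f|<\epsilon p$ for all $n\ge N$; it is relatively uniformly Cauchy if there is $0<p\in E$ such that for every real $\epsilon>0$ there is $N$ with $|f_m-f_n|<\epsilon p$ for all $m,n\ge N$. $E$ is uniformly complete if every relatively uniformly Cauchy sequence in $E$ converges relatively uniformly in $E$. For $A\subseteq E$, the pseudo uniform closure $\overline A$ is the set of all $f\in E$ for which some sequence in $A$ converges relatively uniformly to $f$; put $A_1=A$, $A_{\alpha}=\overline{A_{\alpha-1}}$ if $\alpha>1$ is a successor ordinal, and $A_\alpha=\bigcup_{\beta<\alpha}A_\beta$ if $\alpha$ is a limit ordinal. Write $\omega_1$ for the first uncountable ordinal. A Dedekind completion of $E$ is a pair $(E^\delta,\iota)$ of a Dedekind complete vector lattice $E^\delta$ and an injective vector lattice homomorphism $\iota:E\to E^\delta$ such that every $d\in E^\delta$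 satisfies $d=\sup\{x\in\iota(E):x\le d\}=\inf\{x\in\iota(E):x\ge d\}$. A uniform completion of an Archimedean vector lattice $E$ is a pair $(E^u,\phi)$ such that $E^u$ is a uniformly complete Archimedean vector lattice, $\phi:E\to E^u$ is an injective vector lattice homomorphism, and for every uniformly complete Archimedean vector lattice $F$ and every vector lattice homomorphism $T:E\to F$ there is a unique vector lattice homomorphism $T^u:E^u\to F$ with $T^u\circ\phi=T$. A map $T:E_1\times\dots\times E_s\to F$ between vector lattices is $s$-linear if it is linear in each variable, positive if $T(f_1,\dots,f_s)\ge0$ whenever all $f_k\ge 0$, and an $s$-linear map $T$ is a vector lattice $s$-morphism if for each $k$ and all fixed $f_j\ge0$ $(j\ne k)$ the map $f_k\mapsto T(f_1,\dots,f_s)$ is a vector lattice homomorphism. **Proposition 3.2.** 1. Every Archimedean vector lattice $E$ has a uniform completion. More precisely, $E$ has a Dedekind completion, and for every Dedekind completion $(E^\delta,\iota)$ of $E$ the set $E^u:=\iota(E)_{\omega_1}$ (formed in $E^\delta$) is a vector sublattice of $E^\delta$ containing $\iota(E)$, and $E^u$ together with $\iota:E\to E^u$ is a uniform completion of $E$.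 2. Let $s\ge1$, let $E_1,\dots,E_s,F$ be Archimedean vector lattices with $F$ uniformly complete, let $(E_k^u,\phi_k)$ be a uniform completion of $E_k$ for $k=1,\dots,s$, and let $T:E_1\times\dots\times E_s\to F$ be positive and $s$-linear. Then there is a unique positive $s$-linear map $T^u:E_1^u\times\dots\times E_s^u\to F$ such that $$T^u(\phi_1(f_1),\dots,\phi_s(f_s))=T(f_1,\dots,f_s)\qquad\text{for all } (f_1,\dots,f_s)\in E_1\times\dots\times E_s.$$ Moreover, if $T$ is a vector lattice $s$-morphism, then so is $T^u$. -/

import Mathlib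

open scoped Ordinal

universe u v w

/-- A (real) vector lattice (Riesz space): a real vector space with a lattice order that is
compatible with addition and with multiplication by nonnegative scalars. -/
class VectorLattice (E : Type u) extends AddCommGroup E, Lattice E, Module ℝ E,
    IsOrderedAddMonoid E, IsOrderedModule ℝ E

/-- `E` is Archimedean: if `0 ≤ f` and `n f ≤ g` for all `n`, then `f = 0`.
(Mathlib's `Archimedean` is a different, stronger condition that already fails in `ℝ × ℝ`.) -/
def IsArchimedeanVL (E : Type u) [VectorLattice E] : Prop :=
  ∀ f g : E, 0 ≤ f → (∀ n : ℕ, n • f ≤ g) → f = 0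

/-- A linear map between vector lattices is a vector lattice homomorphism if it preserves
finite suprema and infima. -/
structure IsVectorLatticeHom {E : Type u} {F : Type v} [VectorLattice E] [VectorLattice F]
    (T : E →ₗ[ℝ] F) : Prop where
  map_sup : ∀ f g : E, T (f ⊔ g) = T f ⊔ T g
  map_inf : ∀ f g : E, T (f ⊓ g) = T f ⊓ T g

section RelativelyUniform

variable {E : Type u} [VectorLattice E]

/-- The sequence `f` converges relatively uniformly to `g` in `E`. -/
def RUTendsto (f : ℕ → E) (g : E) : Prop :=
  ∃ p : E, 0 < p ∧ ∀ ε : ℝ, 0 < ε → ∃ N : ℕ, ∀ n, N ≤ n → |f n - g| < ε • p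

/-- The sequence `f` is relatively uniformly Cauchy in `E`. -/
def RUCauchy (f : ℕ → E) : Prop :=
  ∃ p : E, 0 < p ∧ ∀ ε : ℝ, 0 < ε →
    ∃ N : ℕ, ∀ m n, N ≤ m → N ≤ n → |f m - f n| < ε • p

/-- The pseudo uniform closure of `A` in `E`: all relatively uniform limits of sequences in `A`. -/
def pseudoUniformClosure (A : Set E) : Set E :=
  {g | ∃ f : ℕ → E, (∀ n, f n ∈ A) ∧ RUTendsto f g}

/-- The transfinite iterates `A_α` of the pseudo uniform closure: `A_1 = A`, `A_(β + 1)` is the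
pseudo uniform closure of `A_β` for `β ≥ 1`, and `A_α = ⋃_{β < α} A_β` for limit ordinals `α`
(the unused value at `0` is set to be `A`). -/
noncomputable def iteratedClosure (A : Set E) (α : Ordinal.{0}) : Set E :=
  open Classical in
  Ordinal.limitRecOn α A
    (fun β S => if β = 0 then A else pseudoUniformClosure S)
    (fun α _ S => ⋃ (β : Ordinal.{0}) (h : β < α), S β h)

end RelativelyUniform

/-- `E` is uniformly complete: every relatively uniformly Cauchy sequence in `E` converges
relatively uniformly in `E`. -/
def IsUniformlyComplete (E : Type u) [VectorLattice E] : Prop :=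
  ∀ f : ℕ → E, RUCauchy f → ∃ g : E, RUTendsto f g

/-- `(U, φ)` is a uniform completion of `E`. The universal property is required for all test
objects `F` in the universe `Type w`. -/
structure IsUniformCompletion {E : Type u} {U : Type v} [VectorLattice E] [VectorLattice U]
    (φ : E →ₗ[ℝ] U) : Prop where
  archimedean : IsArchimedeanVL U
  uniformlyComplete : IsUniformlyComplete U
  hom : IsVectorLatticeHom φ
  injective : Function.Injective φ
  existsUnique_extension : ∀ (F : Type w) [VectorLattice F],
    IsArchimedeanVL F → IsUniformlyComplete F →
    ∀ T : E →ₗ[ℝ] F, IsVectorLatticeHom T →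
      ∃! Tu : U →ₗ[ℝ] F, IsVectorLatticeHom Tu ∧ Tu ∘ₗ φ = T

/-- `(D, ι)` is a Dedekind completion of `E`: the vector lattice `D` is Dedekind complete, `ι` is an
injective vector lattice homomorphism, and every element of `D` is both the supremum of the
elements of `ι(E)` below it and the infimum of the elements of `ι(E)` above it. -/
structure IsDedekindCompletion {E : Type u} {D : Type v} [VectorLattice E] [VectorLattice D]
    (ι : E →ₗ[ℝ] D) : Prop where
  dedekindComplete : ∀ A : Set D, A.Nonempty → BddAbove A → ∃ d : D, IsLUB A d
  hom : IsVectorLatticeHom ι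
  injective : Function.Injective ι
  isLUB : ∀ d : D, IsLUB {x | x ∈ Set.range ι ∧ x ≤ d} d
  isGLB : ∀ d : D, IsGLB {x | x ∈ Set.range ι ∧ d ≤ x} d

/-- A vector sublattice: a linear subspace closed under binary suprema and infima. -/
structure VectorSublattice (E : Type u) [VectorLattice E] extends Submodule ℝ E, Sublattice E

namespace VectorSublattice

variable {E : Type u} [VectorLattice E]

/-- A vector sublattice is itself a vector lattice under the inherited operations and order. -/
instance (L : VectorSublattice E) : VectorLattice L.toSubmodule where
  toAddCommGroup := inferInstance
  sup x y := ⟨x.1 ⊔ y.1, L.supClosed' x.2 y.2⟩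
  inf x y := ⟨x.1 ⊓ y.1, L.infClosed' x.2 y.2⟩
  le x y := x.1 ≤ y.1
  lt x y := x.1 < y.1
  le_refl x := le_refl x.1
  le_trans _ _ _ h₁ h₂ := le_trans (α := E) h₁ h₂
  lt_iff_le_not_ge _ _ := lt_iff_le_not_ge (α := E)
  le_antisymm _ _ h₁ h₂ := Subtype.ext (le_antisymm h₁ h₂)
  le_sup_left x y := le_sup_left (a := x.1) (b := y.1)
  le_sup_right x y := le_sup_right (a := x.1) (b := y.1)
  sup_le _ _ _ h₁ h₂ := sup_le (α := E) h₁ h₂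
  inf_le_left x y := inf_le_left (a := x.1) (b := y.1)
  inf_le_right x y := inf_le_right (a := x.1) (b := y.1)
  le_inf _ _ _ h₁ h₂ := le_inf (α := E) h₁ h₂
  toModule := inferInstance
  add_le_add_left _ _ h c := add_le_add_left (α := E) h c.1
  smul_le_smul_of_nonneg_left _ hr _ _ h := smul_le_smul_of_nonneg_left (β := E) h hr
  smul_le_smul_of_nonneg_right x hx _ _ h :=
    smul_le_smul_of_nonneg_right (β := E) (b := x.1) h hx

end VectorSublattice

section Multilinear

variable {s : ℕ} {E : Fin s → Type u} {F : Type v} [∀ k, VectorLattice (E k)] [VectorLattice F]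

/-- An `s`-linear map is positive if it maps tuples of positive elements to positive elements. -/
def IsPositiveMultilinear (T : MultilinearMap ℝ E F) : Prop :=
  ∀ f : ∀ k, E k, (∀ k, 0 ≤ f k) → 0 ≤ T f

/-- A vector lattice `s`-morphism: an `s`-linear map that is a vector lattice homomorphism in each
variable whenever the other variables are fixed at positive elements. -/
def IsVectorLatticeMultimorphism (T : MultilinearMap ℝ E F) : Prop :=
  ∀ (k : Fin s) (f : ∀ j, E j), (∀ j, j ≠ k → 0 ≤ f j) → IsVectorLatticeHom (T.toLinearMap f k)

end Multilinear

/-! Everything rests on one notion of density, `IsRUDense`: the image of `E` majorizes `U`, and no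
proper subset of `U` containing it is closed under relatively uniform limits. A positive map `T`
into a uniformly complete Archimedean `F` extends along such an embedding because the closure of its
graph under limits in both coordinates is again the graph of a positive map. The key is
`GraphClosure.le_of_le`: a pair `(x, y)` in the closure with `x ≤ φ e` has `y ≤ T e`. It gives
positivity and single-valuedness, and it turns convergence in `U` into Cauchy estimates in `F`,
hence totality. Two regular maps that agree on a dense image are equal, since the set where they
agree is closed.

For existence, the cuts of `E` form a Dedekind completion. In any Dedekind completion, stage `ω₁` is
the least closed set containing the image, because countably many countable ordinals have a
countable supremum; leastness makes it a sublattice in which the image is dense. A comparison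
through the universal property then shows that the image is dense in every uniform completion.

Multilinear maps are extended one coordinate at a time: their slices are regular, and uniqueness of
regular extensions gives linearity in the remaining coordinates. Uniqueness and the multimorphism
property are conditions closed in each variable, so they pass from the images to the whole product.
-/

section RelativeUniformConvergence

/-! ### Relatively uniform convergence and the maps continuous for it. -/

variable {E : Type u} {F : Type v} [VectorLattice E] [VectorLattice F]

/-- Relatively uniform convergence with respect to a regulator that may vanish. It agrees with
`RUTendsto` in nontrivial spaces. -/
def RUConv (f : ℕ → E) (g : E) : Prop :=
  ∃ p : E, 0 ≤ p ∧ ∀ ε : ℝ, 0 < ε → ∃ N : ℕ, ∀ n, N ≤ n → |f n - g| ≤ ε • p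

/-- Closedness under relatively uniform limits of sequences. -/
def RUClosed (A : Set E) : Prop :=
  ∀ (f : ℕ → E) (g : E), (∀ n, f n ∈ A) → RUConv f g → g ∈ A

theorem nsmul_eq_cast_smul (n : ℕ) (x : E) : n • x = (n : ℝ) • x :=
  (Nat.cast_smul_eq_nsmul ℝ n x).symm

theorem VectorLattice.eq_zero_of_abs_eq_zero {x : E} (h : |x| = 0) : x = 0 := by
  refine le_antisymm (h ▸ le_abs_self x) ?_
  rw [← neg_nonpos]
  exact h ▸ neg_le_abs x

theorem IsArchimedeanVL.nonpos_of_forall_le_smul (hE : IsArchimedeanVL E) {x p : E}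
    (h : ∀ ε : ℝ, 0 < ε → x ≤ ε • p) : x ≤ 0 := by
  have key : x ⊔ 0 = 0 := by
    refine hE (x ⊔ 0) |p| le_sup_right fun n => ?_
    rcases Nat.eq_zero_or_pos n with rfl | hn
    · simp
    · have hn' : (0 : ℝ) < n := Nat.cast_pos.2 hn
      have h1 : x ⊔ 0 ≤ (n : ℝ)⁻¹ • |p| :=
        sup_le ((h _ (inv_pos.2 hn')).trans
          (smul_le_smul_of_nonneg_left (le_abs_self p) (inv_pos.2 hn').le))
          (smul_nonneg (inv_pos.2 hn').le (abs_nonneg p))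
      have h2 := smul_le_smul_of_nonneg_left h1 hn'.le
      rwa [smul_smul, mul_inv_cancel₀ hn'.ne', one_smul, ← nsmul_eq_cast_smul] at h2
  exact key ▸ le_sup_left

theorem RUTendsto.ruConv {f : ℕ → E} {g : E} (h : RUTendsto f g) : RUConv f g := by
  obtain ⟨p, hp, h⟩ := h
  refine ⟨p, hp.le, fun ε hε => ?_⟩
  obtain ⟨N, hN⟩ := h ε hε
  exact ⟨N, fun n hn => (hN n hn).le⟩

theorem smul_lt_smul_of_lt_of_pos {a b : ℝ} (h : a < b) {p : E} (hp : 0 < p) :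
    a • p < b • p := by
  rw [← sub_pos, ← sub_smul]
  refine lt_of_le_of_ne (smul_nonneg (sub_pos.2 h).le hp.le) fun h0 => ?_
  exact hp.ne' ((smul_eq_zero.1 h0.symm).resolve_left (sub_pos.2 h).ne')

/-- Adding `|x|` with `x ≠ 0` makes the regulator strictly positive, and using `ε / 2` makes the
inequality strict. -/
theorem RUConv.ruTendsto [Nontrivial E] {f : ℕ → E} {g : E} (h : RUConv f g) :
    RUTendsto f g := by
  obtain ⟨p, hp, h⟩ := h
  obtain ⟨x, hx⟩ := exists_ne (0 : E)
  have hq : 0 < p + |x| := add_pos_of_nonneg_of_pos hp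
    (lt_of_le_of_ne (abs_nonneg x) fun h0 => hx (VectorLattice.eq_zero_of_abs_eq_zero h0.symm))
  refine ⟨p + |x|, hq, fun ε hε => ?_⟩
  obtain ⟨N, hN⟩ := h (ε / 2) (half_pos hε)
  refine ⟨N, fun n hn => (hN n hn).trans_lt ?_⟩
  exact (smul_le_smul_of_nonneg_left (le_add_of_nonneg_right (abs_nonneg x))
    (half_pos hε).le).trans_lt (smul_lt_smul_of_lt_of_pos (half_lt_self hε) hq)

theorem ruConv_of_subsingleton [Subsingleton E] (f : ℕ → E) (g : E) : RUConv f g :=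
  ⟨0, le_rfl, fun _ _ => ⟨0, fun _ _ => (Subsingleton.elim _ _).le⟩⟩

/-- Uniform completeness with regulators that may vanish. -/
theorem IsUniformlyComplete.exists_ruConv (hE : IsUniformlyComplete E) {f : ℕ → E} {p : E}
    (h : ∀ ε : ℝ, 0 < ε → ∃ N : ℕ, ∀ m n, N ≤ m → N ≤ n → f m - f n ≤ ε • p) :
    ∃ g, RUConv f g := by
  rcases subsingleton_or_nontrivial E with hs | hs
  · exact ⟨0, ruConv_of_subsingleton f 0⟩
  obtain ⟨x, hx⟩ := exists_ne (0 : E)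
  have hq : 0 < |p| + |x| := add_pos_of_nonneg_of_pos (abs_nonneg p)
    (lt_of_le_of_ne (abs_nonneg x) fun h0 => hx (VectorLattice.eq_zero_of_abs_eq_zero h0.symm))
  obtain ⟨g, hg⟩ := hE f ⟨|p| + |x|, hq, fun ε hε => by
    obtain ⟨N, hN⟩ := h (ε / 2) (half_pos hε)
    have h0 : (ε / 2) • p ≤ (ε / 2) • (|p| + |x|) :=
      smul_le_smul_of_nonneg_left
        ((le_abs_self p).trans (le_add_of_nonneg_right (abs_nonneg x))) (half_pos hε).le
    refine ⟨N, fun m n hm hn => lt_of_le_of_lt ?_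
      (smul_lt_smul_of_lt_of_pos (half_lt_self hε) hq)⟩
    -- Exchanging `m` and `n` turns the one-sided hypothesis into a bound on the modulus.
    refine abs_le'.2 ⟨(hN m n hm hn).trans h0, ?_⟩
    rw [neg_sub]
    exact (hN n m hn hm).trans h0⟩
  exact ⟨g, hg.ruConv⟩

theorem ruConv_const (g : E) : RUConv (fun _ => g) g :=
  ⟨0, le_rfl, fun ε _ => ⟨0, fun n _ => by simp⟩⟩

theorem RUConv.add {f f' : ℕ → E} {g g' : E} (h : RUConv f g) (h' : RUConv f' g') :
    RUConv (fun n => f n + f' n) (g + g') := by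
  obtain ⟨p, hp, h⟩ := h
  obtain ⟨p', hp', h'⟩ := h'
  refine ⟨p + p', add_nonneg hp hp', fun ε hε => ?_⟩
  obtain ⟨N, hN⟩ := h ε hε
  obtain ⟨N', hN'⟩ := h' ε hε
  refine ⟨max N N', fun n hn => ?_⟩
  rw [add_sub_add_comm, smul_add]
  exact (abs_add_le _ _).trans (add_le_add (hN n (le_of_max_le_left hn))
    (hN' n (le_of_max_le_right hn)))

theorem abs_smul_le_abs_smul_abs (c : ℝ) (x : E) : |c • x| ≤ |c| • |x| := by
  rcases le_total 0 c with hc | hc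
  · rw [abs_of_nonneg hc]
    refine abs_le'.2 ⟨smul_le_smul_of_nonneg_left (le_abs_self x) hc, ?_⟩
    rw [← smul_neg]
    exact smul_le_smul_of_nonneg_left (neg_le_abs x) hc
  · rw [abs_of_nonpos hc]
    have hc' : 0 ≤ -c := neg_nonneg.2 hc
    refine abs_le'.2 ⟨?_, ?_⟩
    · rw [← neg_smul_neg]
      exact smul_le_smul_of_nonneg_left (neg_le_abs x) hc'
    · rw [← neg_smul]
      exact smul_le_smul_of_nonneg_left (le_abs_self x) hc'

theorem RUConv.smul (c : ℝ) {f : ℕ → E} {g : E} (h : RUConv f g) :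
    RUConv (fun n => c • f n) (c • g) := by
  obtain ⟨p, hp, h⟩ := h
  refine ⟨|c| • p, smul_nonneg (abs_nonneg c) hp, fun ε hε => ?_⟩
  obtain ⟨N, hN⟩ := h ε hε
  refine ⟨N, fun n hn => ?_⟩
  rw [← smul_sub, smul_comm]
  exact (abs_smul_le_abs_smul_abs _ _).trans
    (smul_le_smul_of_nonneg_left (hN n hn) (abs_nonneg c))

theorem RUConv.neg {f : ℕ → E} {g : E} (h : RUConv f g) : RUConv (fun n => -f n) (-g) := by
  simpa using h.smul (-1)

theorem RUConv.sub {f f' : ℕ → E} {g g' : E} (h : RUConv f g) (h' : RUConv f' g') :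
    RUConv (fun n => f n - f' n) (g - g') := by
  simpa [sub_eq_add_neg] using h.add h'.neg

theorem RUConv.abs {f : ℕ → E} {g : E} (h : RUConv f g) : RUConv (fun n => |f n|) |g| := by
  obtain ⟨p, hp, h⟩ := h
  refine ⟨p, hp, fun ε hε => ?_⟩
  obtain ⟨N, hN⟩ := h ε hε
  exact ⟨N, fun n hn => (abs_abs_sub_abs_le (f n) g).trans (hN n hn)⟩

theorem RUConv.eq_of_const (hE : IsArchimedeanVL E) {a g : E} (h : RUConv (fun _ => a) g) :
    a = g := by
  obtain ⟨p, hp, h⟩ := h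
  have h1 : |a - g| ≤ 0 := hE.nonpos_of_forall_le_smul (p := p) fun ε hε => by
    obtain ⟨N, hN⟩ := h ε hε
    exact hN N le_rfl
  exact sub_eq_zero.1 (VectorLattice.eq_zero_of_abs_eq_zero (le_antisymm h1 (abs_nonneg _)))

theorem RUConv.unique (hE : IsArchimedeanVL E) {f : ℕ → E} {g g' : E} (h : RUConv f g)
    (h' : RUConv f g') : g = g' := by
  have h1 := h.sub h'
  simp only [sub_self] at h1
  exact (sub_eq_zero.1 (h1.eq_of_const hE).symm)

/-! ### Positive and regular linear maps -/

/-- A positive linear map between vector lattices. -/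
def IsPositiveLinear (T : E →ₗ[ℝ] F) : Prop := ∀ x, 0 ≤ x → 0 ≤ T x

/-- A regular linear map: a difference of two positive linear maps. -/
def IsRegularLinear (T : E →ₗ[ℝ] F) : Prop :=
  ∃ P Q : E →ₗ[ℝ] F, IsPositiveLinear P ∧ IsPositiveLinear Q ∧ T = P - Q

theorem IsPositiveLinear.mono {T : E →ₗ[ℝ] F} (hT : IsPositiveLinear T) {x y : E} (h : x ≤ y) :
    T x ≤ T y := by
  rw [← sub_nonneg, ← map_sub]
  exact hT _ (sub_nonneg.2 h)

theorem IsPositiveLinear.isRegularLinear {T : E →ₗ[ℝ] F} (hT : IsPositiveLinear T) :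
    IsRegularLinear T :=
  ⟨T, 0, hT, fun _ _ => le_rfl, (sub_zero T).symm⟩

theorem IsPositiveLinear.add {T S : E →ₗ[ℝ] F} (hT : IsPositiveLinear T)
    (hS : IsPositiveLinear S) : IsPositiveLinear (T + S) :=
  fun x hx => add_nonneg (hT x hx) (hS x hx)

theorem IsRegularLinear.add {T S : E →ₗ[ℝ] F} (hT : IsRegularLinear T)
    (hS : IsRegularLinear S) : IsRegularLinear (T + S) := by
  obtain ⟨P, Q, hP, hQ, rfl⟩ := hT
  obtain ⟨P', Q', hP', hQ', rfl⟩ := hS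
  exact ⟨P + P', Q + Q', hP.add hP', hQ.add hQ', by abel⟩

theorem IsRegularLinear.neg {T : E →ₗ[ℝ] F} (hT : IsRegularLinear T) : IsRegularLinear (-T) := by
  obtain ⟨P, Q, hP, hQ, rfl⟩ := hT
  exact ⟨Q, P, hQ, hP, by abel⟩

theorem IsRegularLinear.sub {T S : E →ₗ[ℝ] F} (hT : IsRegularLinear T)
    (hS : IsRegularLinear S) : IsRegularLinear (T - S) := by
  rw [sub_eq_add_neg]
  exact hT.add hS.neg

theorem IsPositiveLinear.smul {c : ℝ} (hc : 0 ≤ c) {T : E →ₗ[ℝ] F} (hT : IsPositiveLinear T) :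
    IsPositiveLinear (c • T) :=
  fun x hx => smul_nonneg hc (hT x hx)

theorem IsRegularLinear.smul (c : ℝ) {T : E →ₗ[ℝ] F} (hT : IsRegularLinear T) :
    IsRegularLinear (c • T) := by
  obtain ⟨P, Q, hP, hQ, rfl⟩ := hT
  rcases le_total 0 c with hc | hc
  · exact ⟨c • P, c • Q, hP.smul hc, hQ.smul hc, smul_sub _ _ _⟩
  · refine ⟨(-c) • Q, (-c) • P, hQ.smul (neg_nonneg.2 hc), hP.smul (neg_nonneg.2 hc), ?_⟩
    rw [← smul_sub, ← neg_sub P Q, neg_smul_neg]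

theorem IsPositiveLinear.abs_le {T : E →ₗ[ℝ] F} (hT : IsPositiveLinear T) (x : E) :
    |T x| ≤ T |x| := by
  refine abs_le'.2 ⟨hT.mono (le_abs_self x), ?_⟩
  rw [← map_neg]
  exact hT.mono (neg_le_abs x)

theorem IsPositiveLinear.ruConv {T : E →ₗ[ℝ] F} (hT : IsPositiveLinear T) {f : ℕ → E} {g : E}
    (h : RUConv f g) : RUConv (fun n => T (f n)) (T g) := by
  obtain ⟨p, hp, h⟩ := h
  refine ⟨T p, hT p hp, fun ε hε => ?_⟩
  obtain ⟨N, hN⟩ := h ε hε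
  refine ⟨N, fun n hn => ?_⟩
  rw [← map_sub, ← map_smul]
  exact (hT.abs_le _).trans (hT.mono (hN n hn))

/-- Regular rather than positive maps are needed later: a slice of a positive multilinear map at a
point with coordinates of arbitrary sign is only regular. -/
theorem IsRegularLinear.ruConv {T : E →ₗ[ℝ] F} (hT : IsRegularLinear T) {f : ℕ → E} {g : E}
    (h : RUConv f g) : RUConv (fun n => T (f n)) (T g) := by
  obtain ⟨P, Q, hP, hQ, rfl⟩ := hT
  exact (hP.ruConv h).sub (hQ.ruConv h)

theorem IsVectorLatticeHom.isPositiveLinear {T : E →ₗ[ℝ] F} (hT : IsVectorLatticeHom T) :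
    IsPositiveLinear T := by
  intro x hx
  have h := hT.map_sup x 0
  rw [sup_of_le_left hx, map_zero] at h
  rw [h]
  exact le_sup_right

theorem IsVectorLatticeHom.map_abs {T : E →ₗ[ℝ] F} (hT : IsVectorLatticeHom T) (x : E) :
    T |x| = |T x| := by
  change T (x ⊔ -x) = T x ⊔ -T x
  rw [hT.map_sup, map_neg]

theorem sup_eq_half_smul_add_add_abs (a b : E) : a ⊔ b = (2⁻¹ : ℝ) • (a + b + |a - b|) := by
  have h : a + b + |a - b| = (2 : ℝ) • (a ⊔ b) := by
    have h1 : |a - b| = (a ⊔ b) + (a ⊔ b) - (a + b) := by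
      have h2 : |b - a| = a ⊔ b - a ⊓ b := (sup_sub_inf_eq_abs_sub a b).symm
      rw [abs_sub_comm, h2]
      have h3 : a ⊓ b + a ⊔ b = a + b := inf_add_sup a b
      rw [← h3]; abel
    rw [h1, two_smul]; abel
  rw [h, smul_smul, inv_mul_cancel₀ two_ne_zero, one_smul]

/-- Suprema are linear expressions in moduli, and infima follow from `f ⊓ g + f ⊔ g = f + g`. -/
theorem isVectorLatticeHom_of_map_abs {T : E →ₗ[ℝ] F} (h : ∀ x, T |x| = |T x|) :
    IsVectorLatticeHom T := by
  have hs : ∀ f g : E, T (f ⊔ g) = T f ⊔ T g := fun f g => by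
    rw [sup_eq_half_smul_add_add_abs, sup_eq_half_smul_add_add_abs (T f)]
    simp [h]
  refine ⟨hs, fun f g => ?_⟩
  have h1 := congrArg T (inf_add_sup f g)
  rw [map_add, map_add, hs, ← inf_add_sup (T f)] at h1
  exact add_right_cancel h1

end RelativeUniformConvergence

/-! ### Extension of maps along a relatively uniformly dense embedding. -/

section Extension

variable {E : Type u} {U : Type v} {F : Type w} [VectorLattice E] [VectorLattice U]
  [VectorLattice F]

/-- The range of `φ` is majorizing in `U`, and `U` is the only relatively uniformly closed subset
of `U` that contains it. -/
structure IsRUDense (φ : E →ₗ[ℝ] U) : Prop where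
  majorizing : ∀ x : U, ∃ e : E, x ≤ φ e
  eq_univ : ∀ A : Set U, RUClosed A → (∀ e, φ e ∈ A) → ∀ x, x ∈ A

/-- The closure of the graph of `T`, viewed as a relation between `U` and `F`, under relatively
uniform limits. -/
inductive GraphClosure (φ : E →ₗ[ℝ] U) (T : E →ₗ[ℝ] F) : U → F → Prop
  | base (e : E) : GraphClosure φ T (φ e) (T e)
  | lim (x : ℕ → U) (y : ℕ → F) (x' : U) (y' : F) (h : ∀ n, GraphClosure φ T (x n) (y n))
      (hx : RUConv x x') (hy : RUConv y y') : GraphClosure φ T x' y'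

namespace GraphClosure

variable {φ : E →ₗ[ℝ] U} {T : E →ₗ[ℝ] F}

theorem add {x x' : U} {y y' : F} (h : GraphClosure φ T x y) (h' : GraphClosure φ T x' y') :
    GraphClosure φ T (x + x') (y + y') := by
  -- Two nested inductions: the second pair is first restricted to the graph of `T`, then allowed to
  -- be a limit.
  have h1 : ∀ e, GraphClosure φ T (x + φ e) (y + T e) := fun e => by
    induction h with
    | base e' =>
      rw [← map_add, ← map_add]
      exact base _
    | lim x y x' y' _ hx hy ih =>
      exact lim _ _ _ _ ih (hx.add (ruConv_const _)) (hy.add (ruConv_const _))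
  induction h' with
  | base e => exact h1 e
  | lim x y x' y' _ hx hy ih =>
    exact lim _ _ _ _ ih ((ruConv_const _).add hx) ((ruConv_const _).add hy)

theorem smul (c : ℝ) {x : U} {y : F} (h : GraphClosure φ T x y) :
    GraphClosure φ T (c • x) (c • y) := by
  induction h with
  | base e =>
    rw [← map_smul, ← map_smul]
    exact base _
  | lim x y x' y' _ hx hy ih => exact lim _ _ _ _ ih (hx.smul c) (hy.smul c)

theorem sub {x x' : U} {y y' : F} (h : GraphClosure φ T x y) (h' : GraphClosure φ T x' y') :
    GraphClosure φ T (x - x') (y - y') := by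
  simpa [sub_eq_add_neg] using h.add (h'.smul (-1))

theorem abs (hφ : IsVectorLatticeHom φ) (hT : IsVectorLatticeHom T) {x : U} {y : F}
    (h : GraphClosure φ T x y) : GraphClosure φ T |x| |y| := by
  induction h with
  | base e =>
    rw [← hφ.map_abs, ← hT.map_abs]
    exact base _
  | lim x y x' y' _ hx hy ih => exact lim _ _ _ _ ih hx.abs hy.abs

/-- Approximants of `x'` need not lie below `φ e`, but they lie below `φ (e + ε • p')` once `φ p'`
majorizes the regulator. Hence `e` stays universally quantified in the induction, and the
Archimedean property of `F` lets `ε` tend to zero. -/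
theorem le_of_le (hφ : IsRUDense φ) (hF : IsArchimedeanVL F) (hT : IsPositiveLinear T)
    (hinj : ∀ e, 0 ≤ φ e → 0 ≤ e) {x : U} {y : F} (h : GraphClosure φ T x y) :
    ∀ e, x ≤ φ e → y ≤ T e := by
  induction h with
  | base e' =>
    intro e he
    refine hT.mono (sub_nonneg.1 (hinj _ ?_))
    rw [map_sub]
    exact sub_nonneg.2 he
  | lim x y x' y' _ hx hy ih =>
    intro e he
    obtain ⟨p, hp, hx⟩ := hx
    obtain ⟨q, hq, hy⟩ := hy
    obtain ⟨p', hp'⟩ := hφ.majorizing p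
    rw [← sub_nonpos]
    refine hF.nonpos_of_forall_le_smul (p := T p' + q) fun ε hε => ?_
    obtain ⟨N, hN⟩ := hx ε hε
    obtain ⟨N', hN'⟩ := hy ε hε
    have h1 : x (max N N') ≤ φ (e + ε • p') := by
      have h2 := (le_abs_self _).trans (hN (max N N') (le_max_left _ _))
      rw [map_add, map_smul]
      have h3 : ε • p ≤ ε • φ p' := smul_le_smul_of_nonneg_left hp' hε.le
      calc x (max N N') = x (max N N') - x' + x' := by abel
        _ ≤ ε • φ p' + φ e := add_le_add (h2.trans h3) he
        _ = _ := add_comm _ _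
    have h4 := ih _ _ h1
    have h5 := (neg_le_abs _).trans (hN' (max N N') (le_max_right _ _))
    rw [map_add, map_smul] at h4
    rw [smul_add]
    calc y' - T e = y (max N N') - T e + -(y (max N N') - y') := by abel
      _ ≤ ε • T p' + ε • q := add_le_add (sub_le_iff_le_add'.2 h4) h5

/-- The set of points having a partner is closed: `le_of_le` applied to differences shows that
partners of a convergent sequence are Cauchy with regulator `T p'`. -/
theorem total (hφ : IsRUDense φ) (hF : IsArchimedeanVL F) (hF' : IsUniformlyComplete F)
    (hT : IsPositiveLinear T) (hinj : ∀ e, 0 ≤ φ e → 0 ≤ e) (x : U) :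
    ∃ y, GraphClosure φ T x y := by
  refine hφ.eq_univ {x | ∃ y, GraphClosure φ T x y} ?_ (fun e => ⟨T e, base e⟩) x
  intro f g hf hfg
  choose y hy using hf
  obtain ⟨p, hp, hfg'⟩ := id hfg
  obtain ⟨p', hp'⟩ := hφ.majorizing p
  obtain ⟨z, hz⟩ := hF'.exists_ruConv (f := y) (p := T p') fun ε hε => by
    obtain ⟨N, hN⟩ := hfg' (ε / 2) (half_pos hε)
    refine ⟨N, fun m n hm hn => ?_⟩
    rw [← map_smul]
    refine ((hy m).sub (hy n)).le_of_le hφ hF hT hinj _ ?_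
    have h1 := (le_abs_self _).trans (hN m hm)
    have h2 := (neg_le_abs _).trans (hN n hn)
    rw [map_smul]
    calc f m - f n = (f m - g) + -(f n - g) := by abel
      _ ≤ (ε / 2) • p + (ε / 2) • p := add_le_add h1 h2
      _ = ε • p := by rw [← add_smul, add_halves]
      _ ≤ ε • φ p' := smul_le_smul_of_nonneg_left hp' hε.le
  exact ⟨z, lim _ _ _ _ hy hfg hz⟩

theorem nonneg (hφ : IsRUDense φ) (hF : IsArchimedeanVL F) (hT : IsPositiveLinear T)
    (hinj : ∀ e, 0 ≤ φ e → 0 ≤ e) {x : U} {y : F} (h : GraphClosure φ T x y) (hx : 0 ≤ x) :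
    0 ≤ y := by
  have h1 := (h.smul (-1)).le_of_le hφ hF hT hinj 0 (by simpa using hx)
  simpa using h1

theorem unique (hφ : IsRUDense φ) (hF : IsArchimedeanVL F) (hT : IsPositiveLinear T)
    (hinj : ∀ e, 0 ≤ φ e → 0 ≤ e) {x : U} {y y' : F} (h : GraphClosure φ T x y)
    (h' : GraphClosure φ T x y') : y = y' := by
  refine le_antisymm ?_ ?_ <;> rw [← sub_nonneg]
  · exact (h'.sub h).nonneg hφ hF hT hinj (sub_self x).ge
  · exact (h.sub h').nonneg hφ hF hT hinj (sub_self x).ge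

end GraphClosure

theorem IsVectorLatticeHom.nonneg_of_map_nonneg {φ : E →ₗ[ℝ] U} (hφ : IsVectorLatticeHom φ)
    (hinj : Function.Injective φ) {e : E} (he : 0 ≤ φ e) : 0 ≤ e := by
  have h : φ (e ⊔ 0) = φ e := by rw [hφ.map_sup, map_zero, sup_of_le_left he]
  rw [← hinj h]
  exact le_sup_right

theorem IsRUDense.exists_positive_extension {φ : E →ₗ[ℝ] U} (hφ : IsRUDense φ)
    (hhom : IsVectorLatticeHom φ) (hinj : Function.Injective φ) (hF : IsArchimedeanVL F)
    (hF' : IsUniformlyComplete F) {T : E →ₗ[ℝ] F} (hT : IsPositiveLinear T) :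
    ∃ R : U →ₗ[ℝ] F, IsPositiveLinear R ∧ (∀ e, R (φ e) = T e) ∧
      (IsVectorLatticeHom T → IsVectorLatticeHom R) := by
  have hnn : ∀ e, 0 ≤ φ e → 0 ≤ e := fun e => hhom.nonneg_of_map_nonneg hinj
  choose R hR using GraphClosure.total hφ hF hF' hT hnn
  have huniq : ∀ x y, GraphClosure φ T x y → R x = y := fun x y h =>
    (hR x).unique hφ hF hT hnn h
  let R' : U →ₗ[ℝ] F :=
    { toFun := R
      map_add' := fun x y => huniq _ _ ((hR x).add (hR y))
      map_smul' := fun c x => huniq _ _ ((hR x).smul c) }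
  exact ⟨R', fun x hx => (hR x).nonneg hφ hF hT hnn hx, fun e => huniq _ _ (.base e),
    fun hT' => isVectorLatticeHom_of_map_abs fun x => huniq _ _ ((hR x).abs hhom hT')⟩

theorem IsRUDense.eq_of_regular {φ : E →ₗ[ℝ] U} (hφ : IsRUDense φ) (hF : IsArchimedeanVL F)
    {R S : U →ₗ[ℝ] F} (hR : IsRegularLinear R) (hS : IsRegularLinear S)
    (h : ∀ e, R (φ e) = S (φ e)) : R = S := by
  ext x
  refine hφ.eq_univ {x | R x = S x} ?_ h x
  intro f g hf hfg
  have h1 := hR.ruConv hfg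
  have h2 := hS.ruConv hfg
  rw [show (fun n => R (f n)) = fun n => S (f n) from funext hf] at h1
  exact h1.unique hF h2

theorem IsRUDense.exists_regular_extension {φ : E →ₗ[ℝ] U} (hφ : IsRUDense φ)
    (hhom : IsVectorLatticeHom φ) (hinj : Function.Injective φ) (hF : IsArchimedeanVL F)
    (hF' : IsUniformlyComplete F) {T : E →ₗ[ℝ] F} (hT : IsRegularLinear T) :
    ∃ R : U →ₗ[ℝ] F, IsRegularLinear R ∧ ∀ e, R (φ e) = T e := by
  obtain ⟨P, Q, hP, hQ, rfl⟩ := hT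
  obtain ⟨P', hP', hPe, -⟩ := hφ.exists_positive_extension hhom hinj hF hF' hP
  obtain ⟨Q', hQ', hQe, -⟩ := hφ.exists_positive_extension hhom hinj hF hF' hQ
  exact ⟨P' - Q', ⟨P', Q', hP', hQ', rfl⟩, fun e => by simp [hPe, hQe]⟩

theorem IsRUDense.isUniformCompletion {φ : E →ₗ[ℝ] U} (hφ : IsRUDense φ)
    (hhom : IsVectorLatticeHom φ) (hinj : Function.Injective φ) (hU : IsArchimedeanVL U)
    (hU' : IsUniformlyComplete U) : IsUniformCompletion.{u, v, w} φ where
  archimedean := hU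
  uniformlyComplete := hU'
  hom := hhom
  injective := hinj
  existsUnique_extension F _ hF hF' T hT := by
    obtain ⟨R, hR, hRe, hRh⟩ :=
      hφ.exists_positive_extension hhom hinj hF hF' hT.isPositiveLinear
    refine ⟨R, ⟨hRh hT, LinearMap.ext hRe⟩, ?_⟩
    rintro S ⟨hS, hSe⟩
    refine hφ.eq_of_regular hF hS.isPositiveLinear.isRegularLinear hR.isRegularLinear fun e => ?_
    rw [hRe, ← hSe, LinearMap.comp_apply]

/-- Being relatively uniformly dense is transported along isomorphisms of vector lattices. -/
theorem IsRUDense.of_inverse {V : Type w} [VectorLattice V] {φ : E →ₗ[ℝ] U} {ψ : E →ₗ[ℝ] V}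
    (hφ : IsRUDense φ) {α : U →ₗ[ℝ] V} {β : V →ₗ[ℝ] U} (hα : IsPositiveLinear α)
    (hαφ : ∀ e, α (φ e) = ψ e) (hαβ : ∀ x, α (β x) = x) :
    IsRUDense ψ where
  majorizing x := by
    obtain ⟨e, he⟩ := hφ.majorizing (β x)
    refine ⟨e, ?_⟩
    rw [← hαφ, ← hαβ x]
    exact hα.mono he
  eq_univ A hA hAe x := by
    rw [← hαβ x]
    refine hφ.eq_univ {y | α y ∈ A} ?_ (fun e => ?_) (β x)
    · exact fun f g hf hfg => hA _ _ hf (hα.ruConv hfg)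
    · change α (φ e) ∈ A
      rw [hαφ]
      exact hAe e

/-- The universal properties give comparison maps both ways. Uniqueness for `ψ` yields `α ∘ β = id`,
which is all the transport of density requires. -/
theorem IsUniformCompletion.isRUDense_of_isRUDense {U V E : Type u} [VectorLattice E]
    [VectorLattice U] [VectorLattice V] {φ : E →ₗ[ℝ] U} {ψ : E →ₗ[ℝ] V}
    (hφ : IsUniformCompletion.{u, u, u} φ) (hφd : IsRUDense φ)
    (hψ : IsUniformCompletion.{u, u, u} ψ) : IsRUDense ψ := by
  obtain ⟨α, ⟨hα, hαφ⟩, -⟩ :=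
    hφ.existsUnique_extension V hψ.archimedean hψ.uniformlyComplete ψ hψ.hom
  obtain ⟨β, ⟨hβ, hβψ⟩, -⟩ :=
    hψ.existsUnique_extension U hφ.archimedean hφ.uniformlyComplete φ hφ.hom
  have hid : α ∘ₗ β = LinearMap.id := by
    refine (hψ.existsUnique_extension V hψ.archimedean hψ.uniformlyComplete ψ hψ.hom).unique
      ⟨⟨fun f g => ?_, fun f g => ?_⟩, ?_⟩ ⟨⟨fun _ _ => rfl, fun _ _ => rfl⟩, rfl⟩
    · simp only [LinearMap.comp_apply, hβ.map_sup, hα.map_sup]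
    · simp only [LinearMap.comp_apply, hβ.map_inf, hα.map_inf]
    · rw [LinearMap.comp_assoc, hβψ, hαφ]
  exact hφd.of_inverse hα.isPositiveLinear (fun e => LinearMap.congr_fun hαφ e)
    (fun x => LinearMap.congr_fun hid x)

end Extension

/-! ### The transfinite closure up to the first uncountable ordinal. -/

section IteratedClosure

variable {E : Type u} [VectorLattice E]

theorem iteratedClosure_zero (A : Set E) : iteratedClosure A 0 = A := by
  simp [iteratedClosure]

theorem iteratedClosure_add_one (A : Set E) (α : Ordinal.{0}) :
    iteratedClosure A (α + 1) =
      if α = 0 then A else pseudoUniformClosure (iteratedClosure A α) := by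
  unfold iteratedClosure
  rw [Ordinal.limitRecOn_add_one]

theorem iteratedClosure_limit (A : Set E) {α : Ordinal.{0}} (h : Order.IsSuccLimit α) :
    iteratedClosure A α = ⋃ (β : Ordinal.{0}) (_ : β < α), iteratedClosure A β := by
  unfold iteratedClosure
  rw [Ordinal.limitRecOn_limit _ _ _ _ h]

theorem iteratedClosure_subset {A B : Set E} (hB : RUClosed B) (hAB : A ⊆ B) (α : Ordinal.{0}) :
    iteratedClosure A α ⊆ B := by
  induction α using Ordinal.limitRecOn with
  | zero => rwa [iteratedClosure_zero]
  | add_one α ih =>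
    rw [iteratedClosure_add_one]
    split_ifs
    · exact hAB
    · rintro g ⟨f, hf, hfg⟩
      exact hB f g (fun n => ih (hf n)) hfg.ruConv
  | limit α hα ih =>
    rw [iteratedClosure_limit A hα]
    exact Set.iUnion₂_subset ih

/-- This fails in the zero space: no regulator is strictly positive there, so every pseudo uniform
closure is empty. -/
theorem subset_pseudoUniformClosure [Nontrivial E] (A : Set E) : A ⊆ pseudoUniformClosure A :=
  fun g hg => ⟨fun _ => g, fun _ => hg, (ruConv_const g).ruTendsto⟩

theorem iteratedClosure_mono [Nontrivial E] (A : Set E) : Monotone (iteratedClosure A) := by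
  intro α β
  induction β using Ordinal.limitRecOn with
  | zero =>
    intro h
    rw [h.eq_zero]
  | add_one β ih =>
    intro h
    rcases h.eq_or_lt with rfl | h
    · exact le_rfl
    · refine (ih (Order.lt_add_one_iff.1 h)).trans ?_
      rw [iteratedClosure_add_one]
      split_ifs with h0
      · rw [h0, iteratedClosure_zero]
      · exact subset_pseudoUniformClosure _
  | limit β hβ ih =>
    intro h
    rcases h.eq_or_lt with rfl | h
    · exact le_rfl
    · rw [iteratedClosure_limit A hβ]
      exact Set.subset_iUnion₂_of_subset α h le_rfl

theorem mem_iteratedClosure_omega_one {A : Set E} {x : E} :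
    x ∈ iteratedClosure A ω₁ ↔ ∃ α < ω₁, x ∈ iteratedClosure A α := by
  rw [iteratedClosure_limit A (Cardinal.isSuccLimit_omega 1)]
  simp

theorem subset_iteratedClosure_omega_one (A : Set E) : A ⊆ iteratedClosure A ω₁ := fun x hx =>
  mem_iteratedClosure_omega_one.2 ⟨0, Ordinal.omega_pos 1, by rwa [iteratedClosure_zero]⟩

/-- The terms of a sequence appear at countably many stages below `ω₁`, whose supremum is still
below `ω₁`; the limit appears soon after it. -/
theorem ruClosed_iteratedClosure_omega_one {A : Set E} (hA : A.Nonempty) :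
    RUClosed (iteratedClosure A ω₁) := by
  intro f g hf hfg
  rcases subsingleton_or_nontrivial E with hs | hs
  · obtain ⟨a, ha⟩ := hA
    rw [Subsingleton.elim g a]
    exact subset_iteratedClosure_omega_one A ha
  choose α hα hfα using fun n => mem_iteratedClosure_omega_one.1 (hf n)
  have hsup : iSup α < ω₁ := Ordinal.iSup_lt_omega_one hα
  have hsucc : iSup α + 1 < ω₁ := (Cardinal.isSuccLimit_omega 1).add_one_lt hsup
  -- The extra successor guarantees a nonzero stage before the closure is taken, since passing from
  -- stage `0` to stage `1` adds nothing.
  refine mem_iteratedClosure_omega_one.2 ⟨iSup α + 1 + 1,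
    (Cardinal.isSuccLimit_omega 1).add_one_lt hsucc, ?_⟩
  rw [iteratedClosure_add_one, if_neg (by simp)]
  refine ⟨f, fun n => ?_, hfg.ruTendsto⟩
  exact iteratedClosure_mono A ((Ordinal.le_iSup α n).trans le_self_add) (hfα n)

end IteratedClosure

/-! ### Dedekind complete vector lattices are Archimedean and uniformly complete. -/

section DedekindComplete

variable {D : Type u} [VectorLattice D]

theorem isArchimedeanVL_of_exists_isLUB
    (hD : ∀ A : Set D, A.Nonempty → BddAbove A → ∃ d, IsLUB A d) : IsArchimedeanVL D := by
  intro f g hf hfg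
  obtain ⟨s, hs⟩ := hD (Set.range fun n : ℕ => n • f) ⟨_, 0, rfl⟩
    ⟨g, by rintro _ ⟨n, rfl⟩; exact hfg n⟩
  refine le_antisymm ?_ hf
  have h : s ≤ s - f := hs.2 <| by
    rintro _ ⟨n, rfl⟩
    rw [le_sub_iff_add_le, ← succ_nsmul]
    exact hs.1 ⟨n + 1, rfl⟩
  simpa using h

theorem exists_ruConv_of_exists_isLUB
    (hD : ∀ A : Set D, A.Nonempty → BddAbove A → ∃ d, IsLUB A d) {f : ℕ → D} {p : D}
    (h : ∀ ε : ℝ, 0 < ε → ∃ N : ℕ, ∀ m n, N ≤ m → N ≤ n → |f m - f n| ≤ ε • p) :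
    ∃ g, ∀ ε : ℝ, 0 < ε → ∃ N : ℕ, ∀ n, N ≤ n → |f n - g| ≤ ε • p := by
  have hle : ∀ ε : ℝ, 0 < ε → ∃ N : ℕ, ∀ m n, N ≤ m → N ≤ n → f m ≤ f n + ε • p := by
    intro ε hε
    obtain ⟨N, hN⟩ := h ε hε
    exact ⟨N, fun m n hm hn => sub_le_iff_le_add'.1 ((le_abs_self _).trans (hN m n hm hn))⟩
  -- The limit is the limit inferior: the supremum of all eventual lower bounds of the sequence.
  set S : Set D := {x | ∃ N, ∀ n, N ≤ n → x ≤ f n}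
  have hlow : ∀ ε : ℝ, ∀ N : ℕ, (∀ m n, N ≤ m → N ≤ n → f m ≤ f n + ε • p) → ∀ m, N ≤ m →
      f m - ε • p ∈ S := fun ε N hN m hm => ⟨N, fun n hn => sub_le_iff_le_add.2 (hN m n hm hn)⟩
  have hup : ∀ ε : ℝ, ∀ N : ℕ, (∀ m n, N ≤ m → N ≤ n → f m ≤ f n + ε • p) → ∀ n, N ≤ n →
      f n + ε • p ∈ upperBounds S := by
    rintro ε N hN n hn x ⟨M, hM⟩
    exact (hM _ (le_max_left M N)).trans (hN _ n (le_max_right M N) hn)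
  obtain ⟨N, hN⟩ := hle 1 one_pos
  obtain ⟨g, hg⟩ := hD S ⟨_, hlow 1 N hN N le_rfl⟩ ⟨_, hup 1 N hN N le_rfl⟩
  refine ⟨g, fun ε hε => ?_⟩
  obtain ⟨N, hN⟩ := hle ε hε
  refine ⟨N, fun n hn => abs_le'.2 ⟨?_, ?_⟩⟩
  · rw [sub_le_comm]
    exact hg.1 (hlow ε N hN n hn)
  · rw [neg_sub, sub_le_iff_le_add']
    exact hg.2 (hup ε N hN n hn)

end DedekindComplete

/-! ### The uniform completion inside a Dedekind completion. -/

section Closure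

variable {E D : Type u} [VectorLattice E] [VectorLattice D] {ι : E →ₗ[ℝ] D}

theorem IsDedekindCompletion.majorizing (h : IsDedekindCompletion ι) (d : D) : ∃ e, d ≤ ι e := by
  rcases Set.eq_empty_or_nonempty {x | x ∈ Set.range ι ∧ d ≤ x} with h0 | ⟨_, ⟨e, rfl⟩, he⟩
  · have hd := h.isGLB d
    rw [h0, isGLB_empty_iff] at hd
    have h1 : d + d ≤ d := hd _
    exact ⟨0, by simpa using h1⟩
  · exact ⟨e, he⟩

/-- A relatively uniformly closed set that is the least one above the range of a vector lattice
homomorphism is a vector sublattice. -/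
def closedHullSublattice (hι : IsVectorLatticeHom ι) (S : Set D) (hS : RUClosed S)
    (hιS : ∀ e, ι e ∈ S) (hmin : ∀ B : Set D, RUClosed B → (∀ e, ι e ∈ B) → S ⊆ B) :
    VectorSublattice D :=
  -- For each operation, the points where the result stays in `S` form a closed set containing the
  -- range, so leastness applies. Addition takes two rounds, one per summand.
  have hsmul : ∀ (c : ℝ) (x : D), x ∈ S → c • x ∈ S := fun c x hx =>
    hmin {x | c • x ∈ S} (fun _ _ hf hfg => hS _ _ hf (hfg.smul c))
      (fun e => by rw [Set.mem_ofPred_eq, ← map_smul]; exact hιS _) hx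
  have habs : ∀ x : D, x ∈ S → |x| ∈ S := fun x hx =>
    hmin {x | |x| ∈ S} (fun _ _ hf hfg => hS _ _ hf hfg.abs)
      (fun e => by rw [Set.mem_ofPred_eq, ← hι.map_abs]; exact hιS _) hx
  have hadd₁ : ∀ (e : E) (x : D), x ∈ S → ι e + x ∈ S := fun e x hx =>
    hmin {x | ι e + x ∈ S} (fun _ _ hf hfg => hS _ _ hf ((ruConv_const _).add hfg))
      (fun e' => by rw [Set.mem_ofPred_eq, ← map_add]; exact hιS _) hx
  have hadd : ∀ x y : D, x ∈ S → y ∈ S → x + y ∈ S := fun x y hx hy =>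
    hmin {x | x + y ∈ S} (fun _ _ hf hfg => hS _ _ hf (hfg.add (ruConv_const _)))
      (fun e => hadd₁ e y hy) hx
  have hsub : ∀ x y : D, x ∈ S → y ∈ S → x - y ∈ S := fun x y hx hy => by
    have h := hadd _ _ hx (hsmul (-1) y hy)
    rwa [neg_one_smul, ← sub_eq_add_neg] at h
  have hsup : ∀ x y : D, x ∈ S → y ∈ S → x ⊔ y ∈ S := fun x y hx hy => by
    rw [sup_eq_half_smul_add_add_abs]
    exact hsmul _ _ (hadd _ _ (hadd _ _ hx hy) (habs _ (hsub _ _ hx hy)))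
  { carrier := S
    add_mem' := fun hx hy => hadd _ _ hx hy
    zero_mem' := by rw [← map_zero ι]; exact hιS 0
    smul_mem' := hsmul
    supClosed' := fun x hx y hy => hsup x y hx hy
    infClosed' := fun x hx y hy => by
      rw [eq_sub_of_add_eq (inf_add_sup x y)]
      exact hsub _ _ (hadd _ _ hx hy) (hsup _ _ hx hy) }

theorem VectorSublattice.isArchimedeanVL (hD : IsArchimedeanVL D) (L : VectorSublattice D) :
    IsArchimedeanVL L.toSubmodule := fun f g hf hfg =>
  Subtype.ext (hD f.1 g.1 hf fun n => hfg n)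

theorem IsDedekindCompletion.exists_isRUDense (h : IsDedekindCompletion ι) :
    ∃ (U : VectorSublattice D) (hι : ∀ f : E, ι f ∈ U.toSubmodule),
      (U.toSubmodule : Set D) = iteratedClosure (Set.range ι) ω₁ ∧
      IsArchimedeanVL U.toSubmodule ∧ IsUniformlyComplete U.toSubmodule ∧
      IsVectorLatticeHom (ι.codRestrict U.toSubmodule hι) ∧
      Function.Injective (ι.codRestrict U.toSubmodule hι) ∧
      IsRUDense (ι.codRestrict U.toSubmodule hι) := by
  have hS := ruClosed_iteratedClosure_omega_one (Set.range_nonempty ι)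
  have hιS : ∀ e, ι e ∈ iteratedClosure (Set.range ι) ω₁ := fun e =>
    subset_iteratedClosure_omega_one _ ⟨e, rfl⟩
  have hmin : ∀ B : Set D, RUClosed B → (∀ e, ι e ∈ B) →
      iteratedClosure (Set.range ι) ω₁ ⊆ B := fun B hB hιB =>
    iteratedClosure_subset hB (Set.range_subset_iff.2 hιB) _
  let U := closedHullSublattice h.hom _ hS hιS hmin
  refine ⟨U, hιS, rfl, U.isArchimedeanVL (isArchimedeanVL_of_exists_isLUB h.dedekindComplete),
    ?_, ⟨fun f g => Subtype.ext (h.hom.map_sup f g), fun f g => Subtype.ext (h.hom.map_inf f g)⟩,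
    fun x y hxy => h.injective (congrArg Subtype.val hxy), ?_, ?_⟩
  · rintro f ⟨p, hp, hf⟩
    obtain ⟨g, hg⟩ := exists_ruConv_of_exists_isLUB h.dedekindComplete
      (f := fun n => (f n : D)) (p := p) fun ε hε => by
        obtain ⟨N, hN⟩ := hf ε hε
        exact ⟨N, fun m n hm hn => (hN m n hm hn).le⟩
    have hgU : g ∈ U.toSubmodule := hS _ g (fun n => (f n).2) ⟨p, hp.le, hg⟩
    have hconv : RUConv f (⟨g, hgU⟩ : U.toSubmodule) := ⟨p, hp.le, hg⟩
    have : Nontrivial U.toSubmodule := ⟨⟨_, _, hp.ne⟩⟩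
    exact ⟨_, hconv.ruTendsto⟩
  · exact fun x => h.majorizing x.1
  · intro A hA hιA x
    have hB : RUClosed {d : D | ∃ hd : d ∈ U.toSubmodule, (⟨d, hd⟩ : U.toSubmodule) ∈ A} := by
      intro f g hf hfg
      choose hfU hfA using hf
      have hgU : g ∈ U.toSubmodule := hS f g hfU hfg
      obtain ⟨p, hp, hfg⟩ := hfg
      -- A regulator in `D` may lie outside the sublattice; majorizing it by `ι e` makes the
      -- convergence internal.
      obtain ⟨e, he⟩ := h.majorizing p
      refine ⟨hgU, hA _ _ hfA ⟨⟨ι e, hιS e⟩, hp.trans he, fun ε hε => ?_⟩⟩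
      obtain ⟨N, hN⟩ := hfg ε hε
      exact ⟨N, fun n hn => (hN n hn).trans (smul_le_smul_of_nonneg_left he hε.le)⟩
    obtain ⟨_, hx⟩ := hmin _ hB (fun e => ⟨hιS e, hιA e⟩) x.2
    exact hx

end Closure

/-! ### Passing from nonnegative scalars to all real scalars. -/

/-- The extension of a semiring homomorphism from the nonnegative reals to a ring to all reals. -/
def realRingHomOfNNReal {R : Type u} [Ring R] (ρ : NNReal →+* R) : ℝ →+* R :=
  -- The value depends only on the difference `a - b`, so sums and products may be computed with any
  -- representation.
  have key : ∀ a b : NNReal, ρ ((a : ℝ) - b).toNNReal - ρ (-((a : ℝ) - b)).toNNReal =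
      ρ a - ρ b := fun a b => by
    rw [sub_eq_sub_iff_add_eq_add, ← map_add, ← map_add]
    congr 1
    apply NNReal.coe_injective
    push_cast [Real.coe_toNNReal']
    rcases le_total (a : ℝ) b with h | h
    · rw [max_eq_right (by linarith), max_eq_left (by linarith)]; ring
    · rw [max_eq_left (by linarith), max_eq_right (by linarith)]; ring
  have rep : ∀ c : ℝ, ∃ a b : NNReal, c = a - b := fun c => by
    refine ⟨c.toNNReal, (-c).toNNReal, ?_⟩
    rw [Real.coe_toNNReal', Real.coe_toNNReal']
    rcases le_total 0 c with h | h
    · rw [max_eq_left h, max_eq_right (by linarith), sub_zero]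
    · rw [max_eq_right h, max_eq_left (by linarith)]; ring
  { toFun := fun c => ρ c.toNNReal - ρ (-c).toNNReal
    map_one' := by simp [Real.toNNReal_of_nonpos]
    map_zero' := by simp
    map_add' := fun c d => by
      obtain ⟨a, b, rfl⟩ := rep c
      obtain ⟨a', b', rfl⟩ := rep d
      rw [show (a - b + (a' - b') : ℝ) = ((a + a' : NNReal) : ℝ) - (b + b' : NNReal) by
        push_cast; ring, key, key, key, map_add, map_add]
      abel
    map_mul' := fun c d => by
      obtain ⟨a, b, rfl⟩ := rep c
      obtain ⟨a', b', rfl⟩ := rep d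
      rw [show ((a - b) * (a' - b') : ℝ) = ((a * a' + b * b' : NNReal) : ℝ)
        - (a * b' + b * a' : NNReal) by push_cast; ring, key, key, key]
      simp only [map_add, map_mul, mul_sub, sub_mul]
      abel }

theorem realRingHomOfNNReal_coe {R : Type u} [Ring R] (ρ : NNReal →+* R) (c : NNReal) :
    realRingHomOfNNReal ρ c = ρ c := by
  change ρ (c : ℝ).toNNReal - ρ (-(c : ℝ)).toNNReal = ρ c
  simp [Real.toNNReal_of_nonpos]

/-! ### Construction of the Dedekind completion by cuts. -/

/-- Cuts of a vector lattice: nonempty, order bounded sets that contain all lower bounds of their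
upper bounds. -/
@[ext] structure OrderCut (E : Type u) [VectorLattice E] where
  carrier : Set E
  nonempty' : carrier.Nonempty
  bddAbove' : BddAbove carrier
  closed' : lowerBounds (upperBounds carrier) ⊆ carrier

namespace OrderCut

variable {E : Type u} [VectorLattice E]

/-- `A.IsUB x` means that `x` is an upper bound of the cut `A`. -/
def IsUB (A : OrderCut E) (x : E) : Prop := x ∈ upperBounds A.carrier

theorem mem_iff (A : OrderCut E) (a : E) : a ∈ A.carrier ↔ ∀ x, A.IsUB x → a ≤ x :=
  ⟨fun ha _ hx => hx ha, fun h => A.closed' fun x hx => h x hx⟩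

/-- A cut is determined by its upper bounds. Algebraic identities are checked on these, where the
closure operation in the definitions of sum and scalar multiple disappears. -/
theorem ext_isUB {A B : OrderCut E} (h : ∀ x, A.IsUB x ↔ B.IsUB x) : A = B := by
  ext a
  simp only [mem_iff, h]

instance : PartialOrder (OrderCut E) where
  le A B := A.carrier ⊆ B.carrier
  le_refl _ := Set.Subset.refl _
  le_trans _ _ _ := Set.Subset.trans
  le_antisymm _ _ h h' := OrderCut.ext (Set.Subset.antisymm h h')

theorem le_iff_isUB {A B : OrderCut E} : A ≤ B ↔ ∀ x, B.IsUB x → A.IsUB x := by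
  refine ⟨fun h x hx a ha => hx (h ha), fun h a ha => ?_⟩
  rw [mem_iff] at ha ⊢
  exact fun x hx => ha x (h x hx)

/-- The cut generated by a nonempty set that is bounded above. -/
def ofSet (S : Set E) (hS : S.Nonempty) (hS' : BddAbove S) : OrderCut E where
  carrier := lowerBounds (upperBounds S)
  nonempty' := hS.mono (subset_lowerBounds_upperBounds S)
  bddAbove' := hS'.imp fun _ hx _ ha => ha hx
  closed' := fun _ ha _ hx => ha fun _ hb => hb hx

theorem isUB_ofSet {S : Set E} {hS : S.Nonempty} {hS' : BddAbove S} {x : E} :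
    (ofSet S hS hS').IsUB x ↔ ∀ s ∈ S, s ≤ x :=
  ⟨fun h _ hs => h (subset_lowerBounds_upperBounds S hs), fun h _ ha => ha h⟩

theorem ofSet_le_iff {S : Set E} {hS : S.Nonempty} {hS' : BddAbove S} {A : OrderCut E} :
    ofSet S hS hS' ≤ A ↔ S ⊆ A.carrier := by
  rw [le_iff_isUB]
  refine ⟨fun h s hs => (A.mem_iff s).2 fun x hx => isUB_ofSet.1 (h x hx) s hs,
    fun h x hx => isUB_ofSet.2 fun s hs => hx (h hs)⟩

theorem mem_of_le {A : OrderCut E} {a b : E} (h : a ≤ b) (hb : b ∈ A.carrier) :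
    a ∈ A.carrier := by
  rw [mem_iff] at hb ⊢
  exact fun x hx => h.trans (hb x hx)

theorem sup_mem {A : OrderCut E} {a b : E} (ha : a ∈ A.carrier) (hb : b ∈ A.carrier) :
    a ⊔ b ∈ A.carrier := by
  rw [mem_iff] at ha hb ⊢
  exact fun x hx => sup_le (ha x hx) (hb x hx)

instance : Lattice (OrderCut E) where
  sup A B := ofSet (A.carrier ∪ B.carrier) (A.nonempty'.mono Set.subset_union_left)
    (A.bddAbove'.union B.bddAbove')
  inf A B :=
    { carrier := A.carrier ∩ B.carrier
      nonempty' := by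
        obtain ⟨a, ha⟩ := A.nonempty'
        obtain ⟨b, hb⟩ := B.nonempty'
        exact ⟨a ⊓ b, mem_of_le inf_le_left ha, mem_of_le inf_le_right hb⟩
      bddAbove' := A.bddAbove'.mono Set.inter_subset_left
      closed' := fun a ha => ⟨A.closed' fun x hx => ha fun b hb => hx hb.1,
        B.closed' fun x hx => ha fun b hb => hx hb.2⟩ }
  le_sup_left A B := Set.subset_union_left.trans (subset_lowerBounds_upperBounds _)
  le_sup_right A B := Set.subset_union_right.trans (subset_lowerBounds_upperBounds _)
  sup_le A B C h h' := ofSet_le_iff.2 (Set.union_subset h h')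
  inf_le_left A B := Set.inter_subset_left
  inf_le_right A B := Set.inter_subset_right
  le_inf A B C h h' := Set.subset_inter h h'

/-- The principal cut of an element. -/
def principal (e : E) : OrderCut E where
  carrier := Set.Iic e
  nonempty' := ⟨e, le_rfl⟩
  bddAbove' := ⟨e, fun _ ha => ha⟩
  closed' := fun _ ha => ha fun _ hb => hb

theorem isUB_principal {e x : E} : (principal e).IsUB x ↔ e ≤ x :=
  ⟨fun h => h (le_refl e), fun h _ ha => le_trans ha h⟩

theorem principal_le_iff {e : E} {A : OrderCut E} : principal e ≤ A ↔ e ∈ A.carrier :=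
  ⟨fun h => h (le_refl e), fun h _ ha => mem_of_le ha h⟩

theorem exists_isLUB (S : Set (OrderCut E)) (hS : S.Nonempty) (hS' : BddAbove S) :
    ∃ A, IsLUB S A := by
  obtain ⟨B, hB⟩ := hS'
  have hne : (⋃ A ∈ S, A.carrier).Nonempty := by
    obtain ⟨A, hA⟩ := hS
    exact A.nonempty'.mono (Set.subset_iUnion₂_of_subset A hA le_rfl)
  have hbdd : BddAbove (⋃ A ∈ S, A.carrier) :=
    B.bddAbove'.mono (Set.iUnion₂_subset fun A hA => hB hA)
  refine ⟨ofSet _ hne hbdd, fun A hA => ?_, fun C hC => ?_⟩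
  · refine Set.Subset.trans ?_ (subset_lowerBounds_upperBounds _)
    exact Set.subset_biUnion_of_mem (u := carrier) hA
  · exact ofSet_le_iff.2 (Set.iUnion₂_subset fun A hA => hC hA)

theorem isLUB_principal (A : OrderCut E) : IsLUB {X | X ∈ Set.range principal ∧ X ≤ A} A := by
  refine ⟨fun X hX => hX.2, fun B hB a ha => ?_⟩
  exact principal_le_iff.1 (hB ⟨⟨a, rfl⟩, principal_le_iff.2 ha⟩)

theorem isGLB_principal (A : OrderCut E) : IsGLB {X | X ∈ Set.range principal ∧ A ≤ X} A := by
  refine ⟨fun X hX => hX.2, fun B hB => le_iff_isUB.2 fun x hx => ?_⟩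
  exact hB ⟨⟨x, rfl⟩, hx⟩

/-! ### Addition and nonnegative scalars -/

instance : Add (OrderCut E) where
  add A B := ofSet (Set.image2 (· + ·) A.carrier B.carrier)
    (A.nonempty'.image2 B.nonempty') (by
      obtain ⟨x, hx⟩ := A.bddAbove'
      obtain ⟨y, hy⟩ := B.bddAbove'
      refine ⟨x + y, ?_⟩
      rintro _ ⟨a, ha, b, hb, rfl⟩
      exact add_le_add (hx ha) (hy hb))

theorem isUB_add {A B : OrderCut E} {x : E} :
    (A + B).IsUB x ↔ ∀ a ∈ A.carrier, ∀ b ∈ B.carrier, a + b ≤ x := by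
  refine isUB_ofSet.trans ⟨fun h a ha b hb => h _ ⟨a, ha, b, hb, rfl⟩, ?_⟩
  rintro h _ ⟨a, ha, b, hb, rfl⟩
  exact h a ha b hb

theorem isUB_add_iff_left {A B : OrderCut E} {x : E} :
    (A + B).IsUB x ↔ ∀ b ∈ B.carrier, A.IsUB (x - b) :=
  isUB_add.trans ⟨fun h b hb a ha => le_sub_iff_add_le.2 (h a ha b hb),
    fun h _ ha _ hb => le_sub_iff_add_le.1 (h _ hb ha)⟩

theorem isUB_add_iff_right {A B : OrderCut E} {x : E} :
    (A + B).IsUB x ↔ ∀ a ∈ A.carrier, B.IsUB (x - a) :=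
  isUB_add.trans ⟨fun h a ha _ hb => le_sub_iff_add_le'.2 (h a ha _ hb),
    fun h a ha _ hb => le_sub_iff_add_le'.1 (h a ha hb)⟩

/-- Translating by one summand at a time shows that generating sets suffice to compute a sum of
cuts; distributivity of scalars relies on this. -/
theorem isUB_ofSet_add_ofSet {S T : Set E} {hS : S.Nonempty} {hS' : BddAbove S}
    {hT : T.Nonempty} {hT' : BddAbove T} {x : E} :
    (ofSet S hS hS' + ofSet T hT hT').IsUB x ↔ ∀ s ∈ S, ∀ t ∈ T, s + t ≤ x := by
  rw [isUB_add_iff_right]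
  constructor
  · intro h s hs t ht
    exact le_sub_iff_add_le'.1
      (isUB_ofSet.1 (h s (subset_lowerBounds_upperBounds S hs)) t ht)
  · refine fun h a ha => isUB_ofSet.2 fun t ht => le_sub_comm.1 ?_
    exact ha fun s hs => le_sub_iff_add_le.2 (h s hs t ht)

instance : Zero (OrderCut E) := ⟨principal 0⟩

theorem isUB_zero {x : E} : (0 : OrderCut E).IsUB x ↔ 0 ≤ x := isUB_principal

instance : AddCommMonoid (OrderCut E) where
  add_comm A B := ext_isUB fun x => by
    rw [isUB_add_iff_left, isUB_add_iff_right]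
  add_assoc A B C := ext_isUB fun x => by
    rw [isUB_add_iff_left, isUB_add_iff_right]
    simp only [isUB_add, isUB_add_iff_left (A := A)]
    constructor
    · intro h a ha b hb c hc
      exact le_sub_iff_add_le'.2 (by
        have := le_sub_iff_add_le.1 (h c hc b hb ha)
        rw [le_sub_iff_add_le] at this
        rwa [← add_assoc])
    · intro h c hc b hb a ha
      have := le_sub_iff_add_le'.1 (h a ha b hb c hc)
      rw [le_sub_iff_add_le, le_sub_iff_add_le]
      rwa [add_assoc]
  zero_add A := ext_isUB fun x => by
    rw [isUB_add_iff_left]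
    exact ⟨fun h a ha => sub_nonneg.1 (isUB_principal.1 (h a ha)),
      fun h a ha => isUB_principal.2 (sub_nonneg.2 (h ha))⟩
  add_zero A := ext_isUB fun x => by
    rw [isUB_add_iff_right]
    exact ⟨fun h a ha => sub_nonneg.1 (isUB_principal.1 (h a ha)),
      fun h a ha => isUB_principal.2 (sub_nonneg.2 (h ha))⟩
  nsmul := nsmulRec

theorem add_mono {A B : OrderCut E} (h : A ≤ B) (C : OrderCut E) : A + C ≤ B + C :=
  le_iff_isUB.2 fun _ hx => isUB_add.2 fun a ha c hc => isUB_add.1 hx a (h ha) c hc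

theorem principal_add (a b : E) : principal (a + b) = principal a + principal b :=
  ext_isUB fun x => by
    rw [isUB_add, isUB_principal]
    exact ⟨fun h c hc d hd => (add_le_add hc hd).trans h, fun h => h a le_rfl b le_rfl⟩

instance : SMul NNReal (OrderCut E) where
  smul c A := ofSet ((fun a => (c : ℝ) • a) '' A.carrier) (A.nonempty'.image _) (by
    obtain ⟨x, hx⟩ := A.bddAbove'
    refine ⟨(c : ℝ) • x, ?_⟩
    rintro _ ⟨a, ha, rfl⟩
    exact smul_le_smul_of_nonneg_left (hx ha) c.2)

theorem isUB_smul {c : NNReal} {A : OrderCut E} {x : E} :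
    (c • A).IsUB x ↔ ∀ a ∈ A.carrier, (c : ℝ) • a ≤ x :=
  isUB_ofSet.trans Set.forall_mem_image

theorem smul_le_iff_le_inv_smul {c : ℝ} (hc : 0 < c) {a x : E} : c • a ≤ x ↔ a ≤ c⁻¹ • x := by
  constructor <;> intro h
  · simpa [smul_smul, hc.ne'] using smul_le_smul_of_nonneg_left h (inv_pos.2 hc).le
  · simpa [smul_smul, hc.ne'] using smul_le_smul_of_nonneg_left h hc.le

theorem isUB_smul_of_pos {c : NNReal} (hc : 0 < c) {A : OrderCut E} {x : E} :
    (c • A).IsUB x ↔ A.IsUB ((c : ℝ)⁻¹ • x) :=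
  isUB_smul.trans (forall₂_congr fun _ _ => smul_le_iff_le_inv_smul (NNReal.coe_pos.2 hc))

theorem zero_smul' (A : OrderCut E) : (0 : NNReal) • A = 0 := ext_isUB fun x => by
  rw [isUB_smul, isUB_zero]
  obtain ⟨a, ha⟩ := A.nonempty'
  exact ⟨fun h => by simpa using h a ha, fun h a _ => by simpa using h⟩

theorem smul_principal (c : NNReal) (e : E) :
    c • principal e = principal ((c : ℝ) • e) := ext_isUB fun x => by
  rw [isUB_smul, isUB_principal]
  exact ⟨fun h => h e le_rfl, fun h a ha => (smul_le_smul_of_nonneg_left ha c.2).trans h⟩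

theorem smul_zero' (c : NNReal) : c • (0 : OrderCut E) = 0 := by
  change c • principal (0 : E) = principal 0
  rw [smul_principal, smul_zero]

instance : Module NNReal (OrderCut E) where
  one_smul A := ext_isUB fun x => by rw [isUB_smul_of_pos one_pos]; simp
  zero_smul := zero_smul'
  smul_zero := smul_zero'
  mul_smul c d A := by
    rcases eq_or_ne c 0 with rfl | hc
    · rw [zero_mul, zero_smul', zero_smul']
    have hc := pos_iff_ne_zero.2 hc
    refine ext_isUB fun x => ?_
    rw [isUB_smul_of_pos hc, isUB_smul, isUB_smul]
    refine forall₂_congr fun a _ => ?_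
    rw [← smul_le_iff_le_inv_smul (NNReal.coe_pos.2 hc), smul_smul, NNReal.coe_mul]
  smul_add c A B := by
    rcases eq_or_ne c 0 with rfl | hc
    · rw [zero_smul', zero_smul', zero_smul', add_zero]
    have hc := pos_iff_ne_zero.2 hc
    refine ext_isUB fun x => ?_
    rw [isUB_smul_of_pos hc, isUB_add]
    refine Iff.trans ?_ isUB_ofSet_add_ofSet.symm
    simp only [Set.forall_mem_image, ← smul_add]
    exact forall₂_congr fun _ _ => forall₂_congr fun _ _ =>
      (smul_le_iff_le_inv_smul (NNReal.coe_pos.2 hc)).symm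
  add_smul c d A := ext_isUB fun x => by
    rw [isUB_smul]
    refine Iff.trans ?_ isUB_ofSet_add_ofSet.symm
    simp only [Set.forall_mem_image]
    constructor
    · intro h a ha b hb
      -- Two different elements of the cut are replaced by their supremum, which again lies in the
      -- cut.
      refine le_trans ?_ (h _ (sup_mem ha hb))
      rw [NNReal.coe_add, add_smul]
      exact add_le_add (smul_le_smul_of_nonneg_left le_sup_left c.2)
        (smul_le_smul_of_nonneg_left le_sup_right d.2)
    · intro h a ha
      rw [NNReal.coe_add, add_smul]
      exact h ha ha

theorem smul_mono (c : NNReal) {A B : OrderCut E} (h : A ≤ B) : c • A ≤ c • B :=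
  le_iff_isUB.2 fun _ hx => isUB_smul.2 fun a ha => isUB_smul.1 hx a (h ha)

/-! ### The vector lattice of cuts -/

instance : Neg (OrderCut E) where
  neg A := ofSet {a | A.IsUB (-a)} (by
      obtain ⟨x, hx⟩ := A.bddAbove'
      refine ⟨-x, ?_⟩
      rwa [Set.mem_ofPred_eq, neg_neg]) (by
      obtain ⟨a, ha⟩ := A.nonempty'
      exact ⟨-a, fun x hx => le_neg_of_le_neg (hx ha)⟩)

theorem isUB_neg {A : OrderCut E} {x : E} : (-A).IsUB x ↔ ∀ y, A.IsUB y → -y ≤ x :=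
  isUB_ofSet.trans ⟨fun h y hy => h (-y) (by rwa [Set.mem_ofPred_eq, neg_neg]),
    fun h s hs => by simpa using h _ hs⟩

theorem nonpos_of_forall_nsmul_le (hE : IsArchimedeanVL E) {x g : E}
    (h : ∀ n : ℕ, n • x ≤ g) : x ≤ 0 := by
  refine hE.nonpos_of_forall_le_smul (p := |g|) fun ε hε => ?_
  obtain ⟨n, hn⟩ := exists_nat_gt ε⁻¹
  have hn' : (0 : ℝ) < n := (inv_pos.2 hε).trans hn
  have h1 := h n
  rw [nsmul_eq_cast_smul, smul_le_iff_le_inv_smul hn'] at h1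
  calc x ≤ (n : ℝ)⁻¹ • g := h1
    _ ≤ (n : ℝ)⁻¹ • |g| := smul_le_smul_of_nonneg_left (le_abs_self g) (inv_pos.2 hn').le
    _ ≤ ε • |g| := smul_le_smul_of_nonneg_right (inv_le_of_inv_le₀ hε hn.le) (abs_nonneg g)

/-- If `x` bounds `-A + A`, then adding `x` to an upper bound of `A` gives another one. Iteration
gives `a ≤ y + n • x` for all `n`, and the Archimedean property forces `0 ≤ x`. -/
theorem neg_add_cancel' (hE : IsArchimedeanVL E) (A : OrderCut E) : -A + A = 0 :=
  ext_isUB fun x => by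
    rw [isUB_add_iff_left, isUB_zero]
    simp only [isUB_neg]
    constructor
    · intro h
      have hstep : ∀ y, A.IsUB y → A.IsUB (y + x) := fun y hy a ha => by
        have := h a ha y hy
        rwa [le_sub_iff_add_le, neg_add_le_iff_le_add] at this
      obtain ⟨y, hy⟩ := A.bddAbove'
      obtain ⟨a, ha⟩ := A.nonempty'
      have hn : ∀ n : ℕ, A.IsUB (y + n • x) := fun n => by
        induction n with
        | zero => rwa [zero_smul, add_zero]
        | succ n ih => rw [succ_nsmul, ← add_assoc]; exact hstep _ ih
      rw [← neg_nonpos]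
      refine nonpos_of_forall_nsmul_le hE (g := y - a) fun n => ?_
      have := hn n ha
      rw [smul_neg, neg_le_sub_iff_le_add']
      rwa [add_comm] at this
    · intro h a ha y hy
      rw [le_sub_iff_add_le, neg_add_le_iff_le_add]
      exact (hy ha).trans (le_add_of_nonneg_right h)

/-- The additive group of cuts of an Archimedean vector lattice. -/
@[reducible] def addCommGroup (hE : IsArchimedeanVL E) : AddCommGroup (OrderCut E) :=
  { (inferInstance : AddCommMonoid (OrderCut E)) with
    neg := fun A => -A
    zsmul := zsmulRec
    neg_add_cancel := neg_add_cancel' hE }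

/-- The action of the real numbers on the cuts of an Archimedean vector lattice. -/
def realAction (hE : IsArchimedeanVL E) :
    letI := addCommGroup hE
    ℝ →+* AddMonoid.End (OrderCut E) :=
  letI := addCommGroup hE
  realRingHomOfNNReal (Module.toAddMonoidEnd NNReal (OrderCut E))

theorem realAction_coe (hE : IsArchimedeanVL E) (c : NNReal) (A : OrderCut E) :
    realAction hE c A = c • A :=
  letI := addCommGroup hE
  DFunLike.congr_fun (realRingHomOfNNReal_coe (Module.toAddMonoidEnd NNReal (OrderCut E)) c) A

theorem realAction_mono (hE : IsArchimedeanVL E) {c : ℝ} (hc : 0 ≤ c) {A B : OrderCut E}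
    (h : A ≤ B) : realAction hE c A ≤ realAction hE c B := by
  lift c to NNReal using hc
  rw [realAction_coe, realAction_coe]
  exact smul_mono c h

/-- The vector lattice of cuts of an Archimedean vector lattice. -/
@[reducible] def vectorLattice (hE : IsArchimedeanVL E) : VectorLattice (OrderCut E) :=
  letI := addCommGroup hE
  letI : Module ℝ (OrderCut E) := Module.compHom (OrderCut E) (realAction hE)
  have hadd : IsOrderedAddMonoid (OrderCut E) := { add_le_add_left := fun _ _ h C => add_mono h C }
  { addCommGroup hE, (inferInstance : Lattice (OrderCut E)),
    (inferInstance : Module ℝ (OrderCut E)) with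
    add_le_add_left := hadd.add_le_add_left
    smul_le_smul_of_nonneg_left := fun c hc A B h => realAction_mono hE hc h
    smul_le_smul_of_nonneg_right := fun A hA c d h => by
      have h1 : (d - c) • (0 : OrderCut E) ≤ (d - c) • A :=
        realAction_mono hE (sub_nonneg.2 h) hA
      rw [smul_zero, sub_smul] at h1
      exact sub_nonneg.1 h1 }

theorem exists_isDedekindCompletion (hE : IsArchimedeanVL E) :
    ∃ (D : Type u) (_ : VectorLattice D) (ι : E →ₗ[ℝ] D), IsDedekindCompletion ι := by
  let _ := vectorLattice hE
  let f : E →+ OrderCut E := AddMonoidHom.mk' principal principal_add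
  have key : ∀ c : ℝ, 0 ≤ c → ∀ e : E, f (c • e) = c • f e := fun c hc e => by
    lift c to NNReal using hc
    exact (smul_principal c e).symm.trans (realAction_coe hE c (principal e)).symm
  let ι : E →ₗ[ℝ] OrderCut E :=
    { f with
      map_smul' := fun c e => by
        change f (c • e) = c • f e
        rcases le_total 0 c with hc | hc
        · exact key c hc e
        · have h := key (-c) (neg_nonneg.2 hc) e
          rwa [neg_smul, neg_smul, map_neg, neg_inj] at h }
  refine ⟨OrderCut E, inferInstance, ι, exists_isLUB, ⟨fun a b => ?_, fun a b => ?_⟩,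
    fun a b h => ?_, isLUB_principal, isGLB_principal⟩
  · change principal (a ⊔ b) = principal a ⊔ principal b
    refine le_antisymm ?_ (sup_le ?_ ?_)
    · rw [principal_le_iff]
      exact sup_mem (principal_le_iff.1 le_sup_left) (principal_le_iff.1 le_sup_right)
    · exact principal_le_iff.2 (le_sup_left (a := a) (b := b))
    · exact principal_le_iff.2 (le_sup_right (a := a) (b := b))
  · refine OrderCut.ext ?_
    exact Set.Iic_inter_Iic.symm
  · have h : principal a = principal b := h
    exact le_antisymm (principal_le_iff.1 h.le) (principal_le_iff.1 h.ge)

end OrderCut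

/-! ### Extension of positive multilinear maps and multimorphisms. -/

section Multilinear

open Function

variable {s : ℕ} {E U : Fin s → Type u} {F : Type w} [∀ k, VectorLattice (E k)]
  [∀ k, VectorLattice (U k)] [VectorLattice F]

/-- `g` is multilinear and positive on the product of the subspaces `V k`. -/
structure IsPositiveMultilinearOn (V : ∀ k, Submodule ℝ (U k)) (g : (∀ k, U k) → F) : Prop where
  map_add : ∀ x : ∀ k, U k, (∀ k, x k ∈ V k) → ∀ k, ∀ a ∈ V k, ∀ b ∈ V k,
    g (update x k (a + b)) = g (update x k a) + g (update x k b)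
  map_smul : ∀ x : ∀ k, U k, (∀ k, x k ∈ V k) → ∀ k (c : ℝ), ∀ a ∈ V k,
    g (update x k (c • a)) = c • g (update x k a)
  nonneg : ∀ x : ∀ k, U k, (∀ k, x k ∈ V k) → (∀ k, 0 ≤ x k) → 0 ≤ g x

theorem update_mem_submodule {V : ∀ k, Submodule ℝ (U k)} {x : ∀ k, U k} (hx : ∀ k, x k ∈ V k)
    {k : Fin s} {a : U k} (ha : a ∈ V k) (j : Fin s) : update x k a j ∈ V j := by
  rcases eq_or_ne j k with rfl | h
  · rwa [update_self]
  · rw [update_of_ne h]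
    exact hx j

namespace IsPositiveMultilinearOn

variable {V : ∀ k, Submodule ℝ (U k)} {g : (∀ k, U k) → F}

/-- The partial linear map obtained by fixing all coordinates but one. -/
def slice (hg : IsPositiveMultilinearOn V g) {x : ∀ k, U k} (hx : ∀ k, x k ∈ V k) {k : Fin s}
    {G : Type u} [VectorLattice G] (ψ : G →ₗ[ℝ] U k) (hψ : ∀ e, ψ e ∈ V k) : G →ₗ[ℝ] F where
  toFun e := g (update x k (ψ e))
  map_add' a b := by rw [_root_.map_add, hg.map_add x hx k _ (hψ a) _ (hψ b)]
  map_smul' c a := by rw [_root_.map_smul, hg.map_smul x hx k c _ (hψ a), RingHom.id_apply]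

variable (hg : IsPositiveMultilinearOn V g) {k : Fin s} {G : Type u} [VectorLattice G]
  {ψ : G →ₗ[ℝ] U k} (hψ : ∀ e, ψ e ∈ V k)

theorem slice_apply {x : ∀ k, U k} (hx : ∀ k, x k ∈ V k) (e : G) :
    hg.slice hx ψ hψ e = g (update x k (ψ e)) := rfl

theorem isPositiveLinear_slice (hpos : IsPositiveLinear ψ) {x : ∀ k, U k}
    (hx : ∀ k, x k ∈ V k) (h0 : ∀ j, j ≠ k → 0 ≤ x j) :
    IsPositiveLinear (hg.slice hx ψ hψ) := by
  intro e he
  refine hg.nonneg _ (update_mem_submodule hx (hψ e)) fun j => ?_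
  rcases eq_or_ne j k with rfl | h
  · rw [update_self]
    exact hpos e he
  · rw [update_of_ne h]
    exact h0 j h

/-- Each fixed coordinate is split into its positive and negative parts, which stay in `V i` because
it is closed under moduli. The induction runs over the set `r` of coordinates whose sign is unknown.
-/
theorem isRegularLinear_slice (hV : ∀ k, ∀ a ∈ V k, |a| ∈ V k) (hpos : IsPositiveLinear ψ)
    {x : ∀ k, U k} (hx : ∀ k, x k ∈ V k) : IsRegularLinear (hg.slice hx ψ hψ) := by
  suffices H : ∀ (r : Finset (Fin s)) (x : ∀ k, U k) (hx : ∀ k, x k ∈ V k),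
      (∀ j, j ∉ r → j ≠ k → 0 ≤ x j) → IsRegularLinear (hg.slice hx ψ hψ) from
    H Finset.univ x hx fun j hj => absurd (Finset.mem_univ j) hj
  intro r
  induction r using Finset.induction_on with
  | empty =>
    intro x hx h0
    exact (hg.isPositiveLinear_slice hψ hpos hx fun j hj => h0 j (by simp) hj).isRegularLinear
  | insert i r hi ih =>
    intro x hx h0
    rcases eq_or_ne i k with rfl | hik
    · exact ih x hx fun j hj hji => h0 j (by simp [hj, hji]) hji
    set a : U i := (2⁻¹ : ℝ) • (|x i| + x i) with ha
    set b : U i := (2⁻¹ : ℝ) • (|x i| - x i) with hb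
    have hab : x i = a + (-1 : ℝ) • b := by
      rw [ha, hb, smul_smul, mul_comm, ← smul_smul, neg_one_smul, ← smul_add,
        show |x i| + x i + -(|x i| - x i) = (2 : ℝ) • x i by rw [two_smul]; abel, smul_smul,
        inv_mul_cancel₀ two_ne_zero, one_smul]
    have haV : a ∈ V i := (V i).smul_mem _ ((V i).add_mem (hV i _ (hx i)) (hx i))
    have hbV : b ∈ V i := (V i).smul_mem _ ((V i).sub_mem (hV i _ (hx i)) (hx i))
    have ha0 : 0 ≤ a := by
      refine smul_nonneg (by norm_num) ?_
      rw [← neg_le_iff_add_nonneg]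
      exact neg_le_abs _
    have hb0 : 0 ≤ b := smul_nonneg (by norm_num) (sub_nonneg.2 (le_abs_self _))
    have hupd : ∀ c : U i, 0 ≤ c → ∀ j, j ∉ r → j ≠ k → 0 ≤ update x i c j := by
      intro c hc j hj hjk
      rcases eq_or_ne j i with rfl | hji
      · rwa [update_self]
      · rw [update_of_ne hji]
        exact h0 j (by simp [hj, hji]) hjk
    have hA := ih _ (update_mem_submodule hx haV) (hupd a ha0)
    have hB := ih _ (update_mem_submodule hx hbV) (hupd b hb0)
    convert hA.sub hB using 1
    ext e
    have hxe := update_mem_submodule hx (hψ e)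
    have h1 := hg.map_add _ hxe i a haV _ ((V i).smul_mem (-1 : ℝ) hbV)
    rw [hg.map_smul _ hxe i _ _ hbV, ← hab] at h1
    rw [LinearMap.sub_apply, slice_apply, slice_apply, slice_apply, update_comm hik,
      update_comm hik, sub_eq_add_neg, ← neg_one_smul ℝ (g _), ← h1, update_comm hik.symm,
      update_eq_self]

end IsPositiveMultilinearOn

/-- This allows the extension of a slice to be chosen once, before the signs of the fixed
coordinates are known. -/
theorem IsRUDense.exists_regular_extension_of_nonneg {E U : Type u} [VectorLattice E]
    [VectorLattice U] {φ : E →ₗ[ℝ] U} (hφ : IsRUDense φ)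
    (hhom : IsVectorLatticeHom φ) (hinj : Injective φ) (hF : IsArchimedeanVL F)
    (hF' : IsUniformlyComplete F) {T : E →ₗ[ℝ] F} (hT : IsRegularLinear T) :
    ∃ R : U →ₗ[ℝ] F, IsRegularLinear R ∧ (∀ e, R (φ e) = T e) ∧
      (IsPositiveLinear T → IsPositiveLinear R) := by
  by_cases hT' : IsPositiveLinear T
  · obtain ⟨R, hR, hRe, -⟩ := hφ.exists_positive_extension hhom hinj hF hF' hT'
    exact ⟨R, hR.isRegularLinear, hRe, fun _ => hR⟩
  · obtain ⟨R, hR, hRe⟩ := hφ.exists_regular_extension hhom hinj hF hF' hT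
    exact ⟨R, hR, hRe, fun h => absurd h hT'⟩

/-- Extension of a positive multilinear map in one of its variables. -/
theorem IsPositiveMultilinearOn.exists_extension_coordinate {V V' : ∀ k, Submodule ℝ (U k)}
    {g : (∀ k, U k) → F} (hg : IsPositiveMultilinearOn V g) (hV : ∀ k, ∀ a ∈ V k, |a| ∈ V k)
    (k : Fin s) {φ : E k →ₗ[ℝ] U k} (hφ : IsRUDense φ) (hhom : IsVectorLatticeHom φ)
    (hinj : Injective φ) (hF : IsArchimedeanVL F) (hF' : IsUniformlyComplete F)
    (hVk : V k = LinearMap.range φ) (hVV' : ∀ j, j ≠ k → V' j = V j) :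
    ∃ g' : (∀ k, U k) → F, IsPositiveMultilinearOn V' g' ∧
      ∀ x, (∀ j, x j ∈ V j) → (∀ j, x j ∈ V' j) → g' x = g x := by
  have hφV : ∀ e, φ e ∈ V k := fun e => hVk ▸ LinearMap.mem_range_self φ e
  -- The `k`-th coordinate may lie outside `V k`; the slice overwrites it, so it is replaced by `0`.
  have h0 : ∀ x : ∀ k, U k, (∀ j, x j ∈ V' j) → ∀ j, update x k 0 j ∈ V j := by
    intro x hx j
    rcases eq_or_ne j k with rfl | hjk
    · rw [update_self]
      exact (V j).zero_mem
    · rw [update_of_ne hjk, ← hVV' j hjk]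
      exact hx j
  have hex : ∀ x : ∀ k, U k, ∃ R : U k →ₗ[ℝ] F, (∀ j, x j ∈ V' j) →
      IsRegularLinear R ∧ (∀ e, R (φ e) = g (update x k (φ e))) ∧
        ((∀ j, j ≠ k → 0 ≤ x j) → IsPositiveLinear R) := by
    intro x
    by_cases hx : ∀ j, x j ∈ V' j
    · obtain ⟨R, hR, hRe, hRp⟩ := hφ.exists_regular_extension_of_nonneg hhom hinj hF hF'
        (hg.isRegularLinear_slice hφV hV hhom.isPositiveLinear (h0 x hx))
      refine ⟨R, fun _ => ⟨hR, fun e => ?_, fun hx0 => hRp ?_⟩⟩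
      · rw [hRe, IsPositiveMultilinearOn.slice_apply, update_idem]
      · refine hg.isPositiveLinear_slice hφV hhom.isPositiveLinear _ fun j hj => ?_
        rw [update_of_ne hj]
        exact hx0 j hj
    · exact ⟨0, fun h => absurd h hx⟩
  choose R hR using hex
  -- Uniqueness among regular extensions is what yields additivity and homogeneity in the other
  -- coordinates.
  have huniq : ∀ (x : ∀ k, U k) (hx : ∀ j, x j ∈ V' j) (S : U k →ₗ[ℝ] F), IsRegularLinear S →
      (∀ e, S (φ e) = g (update x k (φ e))) → R x = S := fun x hx S hS hSe =>
    hφ.eq_of_regular hF (hR x hx).1 hS fun e => ((hR x hx).2.1 e).trans (hSe e).symm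
  have hk : ∀ x : ∀ k, U k, (∀ j, x j ∈ V' j) → ∀ a ∈ V' k, R (update x k a) = R x := by
    intro x hx a ha
    refine huniq _ (update_mem_submodule hx ha) _ (hR x hx).1 fun e => ?_
    rw [update_idem, (hR x hx).2.1]
  have hupd : ∀ x : ∀ k, U k, (∀ j, x j ∈ V' j) → ∀ e j, update x k (φ e) j ∈ V j := by
    intro x hx e j
    have := update_mem_submodule (h0 x hx) (hφV e) j
    rwa [update_idem] at this
  refine ⟨fun x => R x (x k), ⟨fun x hx i a ha b hb => ?_, fun x hx i c a ha => ?_,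
    fun x hx hx0 => ?_⟩, fun x hx hx' => ?_⟩
  · rcases eq_or_ne i k with rfl | hik
    · simp only [hk x hx _ ha, hk x hx _ hb, hk x hx _ ((V' i).add_mem ha hb), update_self,
        _root_.map_add]
    · have hxa := update_mem_submodule hx ha
      have hxb := update_mem_submodule hx hb
      have h1 : R (update x i (a + b)) = R (update x i a) + R (update x i b) := by
        refine huniq _ (update_mem_submodule hx ((V' i).add_mem ha hb)) _
          ((hR _ hxa).1.add (hR _ hxb).1) fun e => ?_
        rw [LinearMap.add_apply, (hR _ hxa).2.1, (hR _ hxb).2.1]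
        simp only [update_comm hik]
        rw [hVV' i hik] at ha hb
        exact (hg.map_add _ (hupd x hx e) i a ha b hb).symm
      simp only [update_of_ne hik.symm, h1, LinearMap.add_apply]
  · rcases eq_or_ne i k with rfl | hik
    · simp only [hk x hx _ ha, hk x hx _ ((V' i).smul_mem c ha), update_self,
        _root_.map_smul]
    · have hxa := update_mem_submodule hx ha
      have h1 : R (update x i (c • a)) = c • R (update x i a) := by
        refine huniq _ (update_mem_submodule hx ((V' i).smul_mem c ha)) _
          ((hR _ hxa).1.smul c) fun e => ?_
        rw [LinearMap.smul_apply, (hR _ hxa).2.1]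
        simp only [update_comm hik]
        rw [hVV' i hik] at ha
        exact (hg.map_smul _ (hupd x hx e) i c a ha).symm
      simp only [update_of_ne hik.symm, h1, LinearMap.smul_apply]
  · exact (hR x hx).2.2 (fun j _ => hx0 j) _ (hx0 k)
  · have hxk := hx k
    rw [hVk] at hxk
    obtain ⟨e, he⟩ := hxk
    change R x (x k) = g x
    rw [← he, (hR x hx').2.1, he, update_eq_self]

variable {φ : ∀ k, E k →ₗ[ℝ] U k}

/-- Here `t` is the set of coordinates already extended. For empty `t`, the map is `T` pulled back
through `invFun`, whose values off the ranges play no role. -/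
theorem exists_isPositiveMultilinearOn (hφ : ∀ k, IsRUDense (φ k))
    (hhom : ∀ k, IsVectorLatticeHom (φ k)) (hinj : ∀ k, Injective (φ k))
    (hF : IsArchimedeanVL F) (hF' : IsUniformlyComplete F) {T : MultilinearMap ℝ E F}
    (hT : IsPositiveMultilinear T) (t : Finset (Fin s)) :
    ∃ g : (∀ k, U k) → F,
      IsPositiveMultilinearOn (fun k => if k ∈ t then ⊤ else LinearMap.range (φ k)) g ∧
        ∀ f : ∀ k, E k, g (fun k => φ k (f k)) = T f := by
  induction t using Finset.induction_on with
  | empty =>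
    have hgT : ∀ f : ∀ k, E k, T (fun k => invFun (φ k) (φ k (f k))) = T f := fun f => by
      congr 1
      funext k
      exact leftInverse_invFun (hinj k) (f k)
    have hupd : ∀ (f : ∀ k, E k) (k : Fin s) (a : E k),
        update (fun k => φ k (f k)) k (φ k a) = fun j => φ j (update f k a j) := fun f k a =>
      funext fun j => (apply_update (fun k => φ k) f k a j).symm
    refine ⟨fun x => T fun k => invFun (φ k) (x k), ⟨?_, ?_, ?_⟩, hgT⟩
    · intro x hx k a ha b hb
      simp only [Finset.notMem_empty, if_false] at hx ha hb
      choose f hf using hx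
      obtain ⟨a, rfl⟩ := ha
      obtain ⟨b, rfl⟩ := hb
      obtain rfl : (fun k => φ k (f k)) = x := funext hf
      simp only [← map_add, hupd, hgT, MultilinearMap.map_update_add]
    · intro x hx k c a ha
      simp only [Finset.notMem_empty, if_false] at hx ha
      choose f hf using hx
      obtain ⟨a, rfl⟩ := ha
      obtain rfl : (fun k => φ k (f k)) = x := funext hf
      simp only [← map_smul, hupd, hgT, MultilinearMap.map_update_smul]
    · intro x hx hx0
      simp only [Finset.notMem_empty, if_false] at hx
      choose f hf using hx
      obtain rfl : (fun k => φ k (f k)) = x := funext hf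
      simp only [hgT]
      exact hT f fun k => (hhom k).nonneg_of_map_nonneg (hinj k) (hx0 k)
  | insert k t hk ih =>
    obtain ⟨g, hg, hgT⟩ := ih
    obtain ⟨g', hg', hgg'⟩ := hg.exists_extension_coordinate
      (V' := fun j => if j ∈ insert k t then ⊤ else LinearMap.range (φ j)) (fun j a ha => by
        split_ifs at ha ⊢
        · exact Submodule.mem_top
        · obtain ⟨e, rfl⟩ := ha
          exact ⟨|e|, (hhom j).map_abs e⟩) k (hφ k) (hhom k) (hinj k) hF hF' (if_neg hk)
        (fun j hj => by simp [hj])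
    refine ⟨g', hg', fun f => (hgg' _ (fun j => ?_) fun j => ?_).trans (hgT f)⟩ <;>
    · split_ifs
      · exact Submodule.mem_top
      · exact ⟨_, rfl⟩

theorem IsPositiveMultilinear.isPositiveMultilinearOn {T : MultilinearMap ℝ U F}
    (hT : IsPositiveMultilinear T) : IsPositiveMultilinearOn (fun _ => ⊤) T where
  map_add x _ k a _ b _ := T.map_update_add x k a b
  map_smul x _ k c a _ := T.map_update_smul x k c a
  nonneg x _ hx := hT x hx

theorem IsPositiveMultilinear.ruConv {T : MultilinearMap ℝ U F} (hT : IsPositiveMultilinear T)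
    (x : ∀ k, U k) (k : Fin s) {f : ℕ → U k} {a : U k} (h : RUConv f a) :
    RUConv (fun n => T (update x k (f n))) (T (update x k a)) :=
  (hT.isPositiveMultilinearOn.isRegularLinear_slice (ψ := LinearMap.id)
    (fun _ => Submodule.mem_top) (fun _ _ _ => Submodule.mem_top) (fun _ h => h)
    (x := x) fun _ => Submodule.mem_top).ruConv h

/-- A property that is closed in each variable holds everywhere if it holds on a relatively
uniformly dense product. -/
theorem IsRUDense.pi_induction (hφ : ∀ k, IsRUDense (φ k)) (P : (∀ k, U k) → Prop)
    (hP : ∀ x k, RUClosed {a | P (update x k a)}) (h0 : ∀ f : ∀ k, E k, P fun k => φ k (f k))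
    (x : ∀ k, U k) : P x := by
  suffices H : ∀ (t : Finset (Fin s)) (x : ∀ k, U k), (∀ j, j ∉ t → ∃ e, φ j e = x j) → P x from
    H Finset.univ x fun j hj => absurd (Finset.mem_univ j) hj
  intro t
  induction t using Finset.induction_on with
  | empty =>
    intro x hx
    choose f hf using fun j => hx j (Finset.notMem_empty j)
    rw [← show (fun k => φ k (f k)) = x from funext hf]
    exact h0 f
  | insert k t hk ih =>
    intro x hx
    rw [← update_eq_self k x]
    refine (hφ k).eq_univ {a | P (update x k a)} (hP x k) (fun e => ih _ fun j hj => ?_) (x k)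
    rcases eq_or_ne j k with rfl | hjk
    · exact ⟨e, by rw [update_self]⟩
    · rw [update_of_ne hjk]
      exact hx j (by simp [hj, hjk])

theorem IsPositiveMultilinear.eq_of_isRUDense (hφ : ∀ k, IsRUDense (φ k))
    (hF : IsArchimedeanVL F) {S T : MultilinearMap ℝ U F} (hS : IsPositiveMultilinear S)
    (hT : IsPositiveMultilinear T)
    (h : ∀ f : ∀ k, E k, S (fun k => φ k (f k)) = T fun k => φ k (f k)) : S = T := by
  ext x
  refine IsRUDense.pi_induction hφ (fun x => S x = T x) (fun x k f a hf hfa => ?_) h x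
  have h1 := hS.ruConv x k hfa
  rw [show (fun n => S (update x k (f n))) = fun n => T (update x k (f n)) from funext hf] at h1
  exact h1.unique hF (hT.ruConv x k hfa)

theorem IsPositiveMultilinear.isVectorLatticeMultimorphism (hφ : ∀ k, IsRUDense (φ k))
    (hhom : ∀ k, IsVectorLatticeHom (φ k)) (hF : IsArchimedeanVL F) {T : MultilinearMap ℝ E F}
    {S : MultilinearMap ℝ U F} (hS : IsPositiveMultilinear S)
    (h : ∀ f : ∀ k, E k, S (fun k => φ k (f k)) = T f) (hT : IsVectorLatticeMultimorphism T) :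
    IsVectorLatticeMultimorphism S := by
  intro k
  have habs : ∀ (x : ∀ k, U k) (i : Fin s) (a : U i),
      (fun j => |update x i a j|) = update (fun j => |x j|) i |a| := fun x i a =>
    funext fun j => apply_update (fun k (y : U k) => |y|) x i a j
  -- Taking moduli of the other coordinates turns a condition on positive points into one meaningful
  -- on the whole product, as the density induction requires.
  have hmain := IsRUDense.pi_induction hφ
    (fun x => |S (update (fun j => |x j|) k (x k))| = S fun j => |x j|)
    (fun x i f a hf hfa => by
      rcases eq_or_ne i k with rfl | hik
      · simp only [Set.mem_ofPred_eq, habs, update_idem, update_self] at hf ⊢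
        have h1 := (hS.ruConv (fun j => |x j|) i hfa).abs
        rw [funext hf] at h1
        exact h1.unique hF (hS.ruConv _ i hfa.abs)
      · simp only [Set.mem_ofPred_eq, habs, update_comm hik, update_of_ne hik.symm] at hf ⊢
        have h1 := (hS.ruConv (update (fun j => |x j|) k (x k)) i hfa.abs).abs
        simp only [← update_comm hik] at h1 hf ⊢
        rw [funext hf] at h1
        exact h1.unique hF (hS.ruConv _ i hfa.abs))
    (fun f => by
      have h1 := (hT k (fun j => |f j|) fun j _ => abs_nonneg _).map_abs (f k)
      simp only [MultilinearMap.toLinearMap_apply] at h1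
      rw [update_eq_self k (fun j => |f j|), ← h, ← h] at h1
      simp only [(hhom _).map_abs] at h1
      rw [h1]
      congr 2
      funext j
      rcases eq_or_ne j k with rfl | hjk
      · simp
      · simp [hjk, (hhom _).map_abs])
  intro f hf
  refine isVectorLatticeHom_of_map_abs fun a => ?_
  have h1 := hmain (update f k a)
  have h2 : update (fun j => |f j|) k |a| = update f k |a| := by
    funext j
    rcases eq_or_ne j k with rfl | hjk
    · simp
    · simp [hjk, abs_of_nonneg (hf j hjk)]
  have h3 : update (fun j => |f j|) k a = update f k a := by
    funext j
    rcases eq_or_ne j k with rfl | hjk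
    · simp
    · simp [hjk, abs_of_nonneg (hf j hjk)]
  rw [habs, update_idem, update_self, h3, h2] at h1
  exact h1.symm

theorem IsPositiveMultilinear.exists_extension (hφ : ∀ k, IsRUDense (φ k))
    (hhom : ∀ k, IsVectorLatticeHom (φ k)) (hinj : ∀ k, Injective (φ k))
    (hF : IsArchimedeanVL F) (hF' : IsUniformlyComplete F) {T : MultilinearMap ℝ E F}
    (hT : IsPositiveMultilinear T) :
    ∃ S : MultilinearMap ℝ U F, IsPositiveMultilinear S ∧
      ∀ f : ∀ k, E k, S (fun k => φ k (f k)) = T f := by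
  obtain ⟨g, hg, hgT⟩ := exists_isPositiveMultilinearOn hφ hhom hinj hF hF' hT Finset.univ
  simp only [Finset.mem_univ, if_true] at hg
  exact ⟨MultilinearMap.mk' g
    (fun x k a b => hg.map_add x (fun _ => Submodule.mem_top) k a Submodule.mem_top b
      Submodule.mem_top)
    (fun x k c a => hg.map_smul x (fun _ => Submodule.mem_top) k c a Submodule.mem_top),
    fun x hx => hg.nonneg x (fun _ => Submodule.mem_top) hx, hgT⟩

end Multilinear

/-- An arbitrary uniform completion is compared with the one built inside the Dedekind completion by
cuts, where density is known. -/
theorem IsUniformCompletion.isRUDense {E U : Type u} [VectorLattice E] [VectorLattice U]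
    (hE : IsArchimedeanVL E) {φ : E →ₗ[ℝ] U} (hφ : IsUniformCompletion.{u, u, u} φ) :
    IsRUDense φ := by
  obtain ⟨D, _, ι, hι⟩ := OrderCut.exists_isDedekindCompletion hE
  obtain ⟨L, hL, -, hA, hC, hhom, hinj, hd⟩ := hι.exists_isRUDense
  exact (hd.isUniformCompletion hhom hinj hA hC).isRUDense_of_isRUDense hd hφ

theorem proposition3p2 :
    -- (1) Existence and construction of the uniform completion.
    (∀ (E : Type u) [VectorLattice E], IsArchimedeanVL E →
      (∃ (D : Type u) (_ : VectorLattice D) (ι : E →ₗ[ℝ] D), IsDedekindCompletion ι) ∧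
      ∀ (D : Type u) [VectorLattice D] (ι : E →ₗ[ℝ] D), IsDedekindCompletion ι →
        ∃ (U : VectorSublattice D) (hι : ∀ f : E, ι f ∈ U.toSubmodule),
          (U.toSubmodule : Set D) = iteratedClosure (Set.range ι) ω₁ ∧
          IsUniformCompletion.{u, u, w} (ι.codRestrict U.toSubmodule hι)) ∧
    -- (2) Extension of positive multilinear maps and of multimorphisms.
    (∀ (s : ℕ), 1 ≤ s →
      ∀ (E U : Fin s → Type u) [∀ k, VectorLattice (E k)] [∀ k, VectorLattice (U k)]
        (φ : ∀ k, E k →ₗ[ℝ] U k) (F : Type w) [VectorLattice F],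
        (∀ k, IsArchimedeanVL (E k)) → (∀ k, IsUniformCompletion.{u, u, u} (φ k)) →
        IsArchimedeanVL F → IsUniformlyComplete F →
        ∀ T : MultilinearMap ℝ E F, IsPositiveMultilinear T →
          ∃ Tu : MultilinearMap ℝ U F,
            (IsPositiveMultilinear Tu ∧ ∀ f : ∀ k, E k, Tu (fun k => φ k (f k)) = T f) ∧
            (∀ S : MultilinearMap ℝ U F, IsPositiveMultilinear S →
              (∀ f : ∀ k, E k, S (fun k => φ k (f k)) = T f) → S = Tu) ∧
            (IsVectorLatticeMultimorphism T → IsVectorLatticeMultimorphism Tu)) := by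
  refine ⟨fun E _ hE => ⟨OrderCut.exists_isDedekindCompletion hE, fun D _ ι hι => ?_⟩, ?_⟩
  · obtain ⟨L, hL, hLc, hA, hC, hhom, hinj, hd⟩ := hι.exists_isRUDense
    exact ⟨L, hL, hLc, hd.isUniformCompletion hhom hinj hA hC⟩
  · intro s _ E U _ _ φ F _ hE hφ hF hF' T hT
    have hd : ∀ k, IsRUDense (φ k) := fun k => (hφ k).isRUDense (hE k)
    obtain ⟨S, hS, hST⟩ := hT.exists_extension hd (fun k => (hφ k).hom)
      (fun k => (hφ k).injective) hF hF'
    exact ⟨S, ⟨hS, hST⟩,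
      fun S' hS' h => hS'.eq_of_isRUDense hd hF hS fun f => (h f).trans (hST f).symm,
      hS.isVectorLatticeMultimorphism hd (fun k => (hφ k).hom) hF hST⟩
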